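/- Let $q=2^e$ with $e>2$. Let $V=\mathbb F_q^4$ carry the nondegenerate alternating form for which $e_1,e_2,f_1,f_2$ is a symplectic basis, and let $G=\mathrm{Sp}_4(q)$ be the isometry group of $V$. All characters are complex, and $\langle\phi,\psi\rangle=|G|^{-1}\sum_{g\in G}\phi(g)\overline{\psi(g)}$ denotes the usual inner product (similarly for subgroups of $G$). A subgroup $H\le G$ is a strong Gelfand subgroup if for every irreducible character $\psi$ of $H$ the induced character $\psi\uparrow G$ is multiplicity free, that is, $\langle\psi\uparrow G,\chi\rangle\le 1$ for every irreducible character $\chi$ of $G$. (1) The maximal parabolic subgroups of $G$ are not strong Gelfand subgroups: for every totally isotropic subspace $U\le V$ of dimension $1$ or $2$, the stabilizer of $U$ in $G$ is not a strong Gelfand subgroup of $G$. (2) No maximal subgroup $H<G$ of the form $E_q^3\colon\mathrm{GL}_2(q)$ (a split extension of a normal elementary abelian subgroup of order $q^3$ by a complement isomorphic to $\mathrm{GL}_2(q)$) is a strong Gelfand subgroup of $G$. (3) Let $P$ be the stabilizer of $\langle e_1,e_2\rangle$, that is, the group of all block matrices $\begin{pmatrix}A&B\\0&D\end{pmatrix}\in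 G$, and let $B_0\le P$ be the stabilizer of the flag $\langle e_1\rangle<\langle e_1,e_2\rangle$. Let $\gamma\colon\mathbb F_q^\times\to\mathbb C^\times$ be any injective homomorphism and $\psi$ any nontrivial additive character of $\mathbb F_q$. Let $\chi_1(m,n)$ be the character of $G$ induced from the linear character $g\mapsto\gamma(A_{11})^m\gamma(A_{22})^n$ of $B_0$. Let $\chi_5(k)$ be the character of $P$ induced from the linear character $$\begin{pmatrix}1&X\\0&1\end{pmatrix}\operatorname{diag}(t,t^{-1},t^{-1},t)\mapsto\gamma(t)^k\,\psi(X_{12})$$ of the subgroup of $P$ of all such products ($X$ a symmetric $2\times 2$ matrix over $\mathbb F_q$, $t\in\mathbb F_q^\times$). Then $\chi_5(q-4)$ is an irreducible character of $P$, $\chi_1(1,2)$ is an irreducible character of $G$, and $$\langle\chi_5(q-4),\ \chi_1(1,2)\downarrow P\rangle=2 .$$ -/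

import Mathlib

open scoped Matrix ComplexConjugate

noncomputable section

namespace StrongGelfand

/-! ### Complex characters of finite groups -/

/-- `χ` is the character of an irreducible complex representation of `G`. -/
def IsIrrChar {G : Type*} [Group G] (χ : G → ℂ) : Prop :=
  ∃ (n : ℕ) (ρ : Representation ℂ G (Fin n → ℂ)), ρ.IsIrreducible ∧ ρ.character = χ

/-- The inner product `⟨φ, ψ⟩ = |G|⁻¹ ∑ φ(g) conj (ψ(g))`. -/
def charInner {G : Type*} [Group G] [Finite G] (φ ψ : G → ℂ) : ℂ :=
  letI := Fintype.ofFinite G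
  (Nat.card G : ℂ)⁻¹ * ∑ g : G, φ g * conj (ψ g)

/-- Restriction of a function on `G` to a subgroup. -/
def resChar {G : Type*} [Group G] (H : Subgroup G) (φ : G → ℂ) : H → ℂ :=
  fun h => φ h

open Classical in
/-- The induced class function
`φ↑G (g) = |H|⁻¹ ∑_{x ∈ G, x⁻¹ g x ∈ H} φ(x⁻¹ g x)`. -/
def indChar {G : Type*} [Group G] [Finite G] (H : Subgroup G) (φ : H → ℂ) : G → ℂ :=
  letI := Fintype.ofFinite G
  fun g => (Nat.card H : ℂ)⁻¹ *
    ∑ x : G, if h : x⁻¹ * g * x ∈ H then φ ⟨x⁻¹ * g * x, h⟩ else 0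

/-- All multiplicities `⟨χ, ψ⟩`, `ψ` irreducible, are at most one.  For a character `χ`
these inner products are natural numbers, so that taking the real part changes nothing. -/
def IsMultiplicityFree {G : Type*} [Group G] [Finite G] (χ : G → ℂ) : Prop :=
  ∀ ψ : G → ℂ, IsIrrChar ψ → (charInner χ ψ).re ≤ 1

/-- `(G, H)` is a strong Gelfand pair: every irreducible character of `H` induces to a
multiplicity-free character of `G`. -/
def IsStrongGelfand {G : Type*} [Group G] [Finite G] (H : Subgroup G) : Prop :=
  ∀ ψ : H → ℂ, IsIrrChar ψ → IsMultiplicityFree (indChar H ψ)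

/-! ### The symplectic group `Sp₄(F)` and its parabolic subgroups -/

variable (F : Type*) [Field F]

/-- Column vectors, with the symplectic basis `e₁, e₂, f₁, f₂` indexed by
`inl 0, inl 1, inr 0, inr 1`. -/
abbrev Vec : Type _ := Fin 2 ⊕ Fin 2 → F

/-- The group of `4 × 4` matrices preserving the alternating form with matrix `J`. -/
abbrev Sp4 : Type _ := Matrix.symplecticGroup (Fin 2) F

variable {F}

/-- `U` is totally isotropic for the alternating form `(u, v) ↦ uᵀ J v`. -/
def IsTotallyIsotropic (U : Submodule F (Vec F)) : Prop :=
  ∀ u ∈ U, ∀ v ∈ U, u ⬝ᵥ (Matrix.J (Fin 2) F *ᵥ v) = 0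

/-- The stabilizer `{g | g U = U}` of a subspace. -/
def stab (U : Submodule F (Vec F)) : Subgroup (Sp4 F) where
  carrier := {g | U.map (g : Matrix (Fin 2 ⊕ Fin 2) (Fin 2 ⊕ Fin 2) F).mulVecLin = U}
  one_mem' := by simp
  mul_mem' := by
    intro a b ha hb
    simp only [Set.mem_ofPred_eq] at ha hb ⊢
    rw [Submonoid.coe_mul, Matrix.mulVecLin_mul, Submodule.map_comp, hb, ha]
  inv_mem' := by
    intro a ha
    simp only [Set.mem_ofPred_eq] at ha ⊢
    conv_lhs => rw [← ha]
    rw [← Submodule.map_comp, ← Matrix.mulVecLin_mul, ← Submonoid.coe_mul, inv_mul_cancel]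
    simp

variable (F)

/-- The line spanned by `e₁`. -/
def stdLine : Submodule F (Vec F) :=
  Submodule.span F {Pi.single (Sum.inl 0) 1}

/-- The totally isotropic plane spanned by `e₁` and `e₂`. -/
def stdPlane : Submodule F (Vec F) :=
  Submodule.span F {Pi.single (Sum.inl 0) 1, Pi.single (Sum.inl 1) 1}

/-- The maximal parabolic subgroup `P`: the stabilizer of `⟨e₁, e₂⟩`, that is, the
symplectic matrices in block form `(A B; 0 D)`. -/
def parabolicP : Subgroup (Sp4 F) := stab (stdPlane F)

/-- The Borel subgroup: the stabilizer of the flag `⟨e₁⟩ < ⟨e₁, e₂⟩`. -/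
def borel : Subgroup (Sp4 F) := stab (stdLine F) ⊓ stab (stdPlane F)

variable {F}

/-- The `(i, j)` entry of the upper left block `A` of `g = (A B; C D)`. -/
def blkA (g : Sp4 F) (i j : Fin 2) : F := g.1 (Sum.inl i) (Sum.inl j)

/-- The `(i, j)` entry of the upper right block `B` of `g = (A B; C D)`. -/
def blkB (g : Sp4 F) (i j : Fin 2) : F := g.1 (Sum.inl i) (Sum.inr j)

theorem lowerLeft_eq_zero {g : Sp4 F} (hg : g ∈ parabolicP F) (i j : Fin 2) :
    g.1 (Sum.inr i) (Sum.inl j) = 0 := by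
  have hU : ∀ v ∈ stdPlane F, v (Sum.inr i) = 0 := by
    intro v hv
    obtain ⟨a, b, rfl⟩ := Submodule.mem_span_pair.1 hv
    simp
  have hj : (Pi.single (Sum.inl j) 1 : Vec F) ∈ stdPlane F := by
    apply Submodule.subset_span
    fin_cases j <;> simp
  have hmap : (stdPlane F).map (g : Matrix (Fin 2 ⊕ Fin 2) (Fin 2 ⊕ Fin 2) F).mulVecLin
      = stdPlane F := hg
  have := hU _ (hmap ▸ Submodule.mem_map_of_mem hj)
  simpa using this

theorem blkA_mul {g h : Sp4 F} (hh : h ∈ parabolicP F) (i j : Fin 2) :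
    blkA (g * h) i j = blkA g i 0 * blkA h 0 j + blkA g i 1 * blkA h 1 j := by
  simp [blkA, Matrix.mul_apply, lowerLeft_eq_zero hh]

theorem blkA_one (i j : Fin 2) : blkA (1 : Sp4 F) i j = if i = j then 1 else 0 := by
  simp [blkA, Matrix.one_apply]

variable (F)

/-- The subgroup of those `(A B; 0 D) ∈ P` for which `A = diag(t, t⁻¹)`. -/
def hyperbolicSubgroup : Subgroup (parabolicP F) where
  carrier := {g | blkA (g : Sp4 F) 0 1 = 0 ∧ blkA (g : Sp4 F) 1 0 = 0 ∧
    blkA (g : Sp4 F) 0 0 * blkA (g : Sp4 F) 1 1 = 1}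
  one_mem' := by simp [blkA_one]
  mul_mem' := by
    rintro a b ⟨ha1, ha2, ha3⟩ ⟨hb1, hb2, hb3⟩
    refine ⟨?_, ?_, ?_⟩ <;> simp only [Subgroup.coe_mul, blkA_mul b.2, ha1, ha2, hb1, hb2]
    · ring
    · ring
    · linear_combination hb3 * blkA (a : Sp4 F) 0 0 * blkA (a : Sp4 F) 1 1 + ha3
  inv_mem' := by
    rintro a ⟨ha1, ha2, ha3⟩
    have key : ∀ i j, blkA (a : Sp4 F) i 0 * blkA ((a⁻¹ : parabolicP F) : Sp4 F) 0 j +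
        blkA (a : Sp4 F) i 1 * blkA ((a⁻¹ : parabolicP F) : Sp4 F) 1 j
        = if i = j then 1 else 0 := by
      intro i j
      rw [← blkA_mul a⁻¹.2, ← Subgroup.coe_mul, mul_inv_cancel, Subgroup.coe_one, blkA_one]
    have k00 := key 0 0
    have k01 := key 0 1
    have k10 := key 1 0
    have k11 := key 1 1
    have h0 := left_ne_zero_of_mul_eq_one ha3
    have h1 := right_ne_zero_of_mul_eq_one ha3
    simp only [ha1, ha2, zero_mul, add_zero, zero_add] at k00 k01 k10 k11
    simp only [reduceIte, zero_ne_one, one_ne_zero, mul_eq_zero, h0, h1, false_or]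
      at k00 k01 k10 k11
    refine ⟨k01, k10, ?_⟩
    linear_combination (-(blkA ((a⁻¹ : parabolicP F) : Sp4 F) 0 0 *
      blkA ((a⁻¹ : parabolicP F) : Sp4 F) 1 1)) * ha3 + k00 * blkA (a : Sp4 F) 1 1 *
      blkA ((a⁻¹ : parabolicP F) : Sp4 F) 1 1 + k11

/-! ### The characters `χ₁(m, n)` of `Sp₄(F)` and `χ₅(k)` of `P` -/

variable {F}
variable [Fintype F]

/-- The principal series character `χ₁(m, n)`: induced from the linear character
`g ↦ γ(t)ᵐ γ(s)ⁿ` of the Borel subgroup, where `(t, s)` is the diagonal of the block `A`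
of `g` and `γ : Fˣ → ℂˣ` is a fixed embedding. -/
def chi1 (γ : Fˣ →* ℂˣ) (m n : ℕ) : Sp4 F → ℂ :=
  indChar (borel F) fun g =>
    MulChar.ofUnitHom γ (blkA (g : Sp4 F) 0 0) ^ m * MulChar.ofUnitHom γ (blkA (g : Sp4 F) 1 1) ^ n

/-- The character `χ₅(k)` of `P`: induced from the linear character
`(1 X; 0 1) · diag(t, t⁻¹, t⁻¹, t) ↦ γ(t)ᵏ ψ(X₁₂)` of the subgroup of those `(A B; 0 D)` with
`A = diag(t, t⁻¹)`.  For `g = (A B; 0 D)` in this subgroup, `X = B D⁻¹ = B Aᵀ`, and so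
`X₁₂ = B₁₂ A₂₂`. -/
def chi5 (γ : Fˣ →* ℂˣ) (ψ : AddChar F ℂ) (k : ℕ) : parabolicP F → ℂ :=
  indChar (hyperbolicSubgroup F) fun g =>
    MulChar.ofUnitHom γ (blkA (g : Sp4 F) 0 0) ^ k * ψ (blkB (g : Sp4 F) 0 1 * blkA (g : Sp4 F) 1 1)

variable (F) in
/-- `H` is of shape `E_q³ : GL₂(q)` with `q = |F|` a power of two: a split extension of a normal
elementary abelian 2-subgroup of order `q³` by `GL₂(q)`. -/
def HasShape {G : Type*} [Group G] (H : Subgroup G) : Prop :=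
  ∃ N K : Subgroup H, N.Normal ∧ (∀ x ∈ N, x ^ 2 = 1) ∧ Nat.card N = Fintype.card F ^ 3 ∧
    N.IsComplement' K ∧ Nonempty (K ≃* GL (Fin 2) F)

end StrongGelfand

end

/-!
The characters `χ₁(1, 2)` and `χ₅(k)` are induced from linear characters, so every inner product
involved is a count of double cosets: by Mackey's formula (`charInner_comp_indChar`), the
multiplicity between two such characters is the number of double cosets `K x B` such that the two
linear characters agree on `K ∩ x B x⁻¹` (`AgreeAt`). To discard a double coset it suffices to
exhibit one element on which they differ.

* The diagonal torus acts on the flags of basis vectors through the Weyl group of order eight. The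
  weight `(1, 2)` has trivial stabilizer there because `Fˣ` has an element of order at least seven,
  so only the Borel subgroup itself survives and `χ₁(1, 2)` is irreducible
  (`mem_borel_of_agreeAt`).
* On the unipotent radical of `P`, the character `ψ(X₁₂)` is stabilized only by the monomial
  matrices of determinant one up to sign, and a torus element `t` with `t ^ (2 * k) ≠ 1` separates
  the two cosets of the diagonal ones; so `χ₅(k)` is irreducible (`mem_hyperbolic_of_agreeAt`).
* Exactly two double cosets support the pair `χ₅(q - 4)`, `χ₁(1, 2)`: those of the flags
  `⟨f₁⟩ < ⟨f₁, e₂⟩`, on which the weights match because `q - 4 = -3` modulo `q - 1`, and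
  `⟨f₁ + f₂⟩ < ⟨f₁, f₂⟩`, whose stabilizer meets the subgroup inducing `χ₅` trivially
  (`exists_eq_mul_of_agreeAt`, `agreeAt_weylFlip`, `agreeAt_genericFlag`). Hence the multiplicity
  is two, and by Frobenius reciprocity `P` is not a strong Gelfand subgroup.

All totally isotropic planes are conjugate to `⟨e₁, e₂⟩`, and all lines to `⟨e₁⟩`. In characteristic
two the exceptional graph automorphism, realized by the action of `Sp₄(F)` on the four-dimensional
space `ω^⊥ / ω` in the exterior square of `V`, interchanges the stabilizers of lines and of
totally isotropic planes (`mem_stab_stdLine_iff_graphEquiv_mem`), which settles the stabilizers of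
lines.

A maximal subgroup `H` with a nontrivial normal 2-subgroup `N` is one of these parabolic subgroups:
if `W` is the space of vectors fixed by `N`, then `N` acts on `W^⊥`, so it fixes a nonzero vector
there, and `H` stabilizes the nonzero totally isotropic space `W ∩ W^⊥`
(`exists_eq_stab_of_isCoatom`).
-/

noncomputable section

namespace StrongGelfand

/-! ### Characters of finite groups -/

section Characters

variable {G : Type*} [Group G]

theorem norm_monoidHom_eq_one [Finite G] (lam : G →* ℂ) (g : G) : ‖lam g‖ = 1 :=
  Complex.norm_eq_one_of_pow_eq_one (n := Nat.card G)
    (by rw [← map_pow, pow_card_eq_one', map_one]) Nat.card_pos.ne'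

theorem conj_monoidHom [Finite G] (lam : G →* ℂ) (g : G) : conj (lam g) = lam g⁻¹ := by
  rw [← RCLike.inv_eq_conj (norm_monoidHom_eq_one lam g)]
  exact inv_eq_of_mul_eq_one_left (by rw [← map_mul, inv_mul_cancel, map_one])

/-- A representation whose endomorphism algebra is one-dimensional is irreducible: the projection
onto an invariant subspace along an invariant complement is a scalar. -/
theorem isIrreducible_of_finrank_eq_one [Finite G] {V : Type*} [AddCommGroup V] [Module ℂ V]
    [FiniteDimensional ℂ V] (ρ : Representation ℂ G V)
    (h : Module.finrank ℂ (Representation.IntertwiningMap ρ ρ) = 1) : ρ.IsIrreducible := by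
  have hNZ : NeZero (Nat.card G : ℂ) := ⟨by exact_mod_cast Nat.card_pos.ne'⟩
  rw [Representation.irreducible_iff_isSimpleModule_asModule, isSimpleModule_iff]
  have h1 : (1 : Representation.IntertwiningMap ρ ρ) ≠ 0 := by
    intro h0
    have : Subsingleton (Representation.IntertwiningMap ρ ρ) :=
      ⟨fun a b => by rw [← mul_one a, ← mul_one b, h0, mul_zero, mul_zero]⟩
    rw [Module.finrank_zero_of_subsingleton] at h
    exact zero_ne_one h
  refine { exists_pair_ne := ⟨⊥, ⊤, fun hbt => h1 ?_⟩, eq_bot_or_eq_top := fun p => ?_ }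
  · ext v
    have hv : (show ρ.asModule from v) ∈ (⊥ : Submodule (MonoidAlgebra ℂ G) ρ.asModule) := by
      rw [hbt]; trivial
    have h0 := (Submodule.mem_bot (MonoidAlgebra ℂ G)).1 hv
    exact h0
  · obtain ⟨q, hpq⟩ := MonoidAlgebra.Submodule.exists_isCompl (k := ℂ) p
    let π : ρ.asModule →ₗ[MonoidAlgebra ℂ G] ρ.asModule := p.projection q hpq
    obtain ⟨c, hc⟩ := (finrank_eq_one_iff_of_nonzero' _ h1).1 h
      ((Representation.IntertwiningMap.equivLinearMapAsModule ρ ρ).symm π)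
    set f := (Representation.IntertwiningMap.equivLinearMapAsModule ρ ρ).symm π with hf
    have hcv : ∀ v : V, f v = c • v := fun v => by rw [← hc]; rfl
    have hfix : ∀ v : V, @Membership.mem ρ.asModule _ _ p v → f v = v := fun v hv =>
      congrArg (fun w : p => (show V from (w : ρ.asModule)))
        (Submodule.projectionOnto_apply_left hpq ⟨v, hv⟩)
    have hmem : ∀ v : V, @Membership.mem ρ.asModule _ _ p (f v) := fun v =>
      Submodule.projection_apply_mem hpq _
    by_cases hc0 : c = 0
    · left
      rw [eq_bot_iff]
      intro v hv
      have h3 : ∀ w : V, @Membership.mem ρ.asModule _ _ p w → w = 0 := fun w hw => by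
        rw [← hfix w hw, hcv, hc0, zero_smul]
      exact (Submodule.mem_bot _).2 (h3 v hv)
    · right
      rw [eq_top_iff]
      intro v _
      have h3 : ∀ w : V, @Membership.mem ρ.asModule _ _ p w := fun w => by
        have h4 := hmem (c⁻¹ • w)
        rwa [hcv, smul_smul, mul_inv_cancel₀ hc0, one_smul] at h4
      exact h3 v

/-- The monomial matrix representation of `G` on `G ⧸ K` attached to a linear character of `K`:
with a section `s` of `G → G ⧸ K`, the entry at `(y, x)` is `lam (s(y)⁻¹ g s(x))`, read as zero
outside `K`. -/
def monomialMatrix (K : Subgroup G) (lam : K →* ℂ) (g : G) : Matrix (G ⧸ K) (G ⧸ K) ℂ :=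
  open Classical in
  fun y x => if h : y.out⁻¹ * g * x.out ∈ K then lam ⟨_, h⟩ else 0

theorem monomialMatrix_mul (K : Subgroup G) [Fintype (G ⧸ K)] (lam : K →* ℂ)
    (g h : G) :
    monomialMatrix K lam (g * h) = monomialMatrix K lam g * monomialMatrix K lam h := by
  classical
  ext z x
  rw [Matrix.mul_apply]
  have hy : ∀ y : G ⧸ K, y.out⁻¹ * h * x.out ∈ K ↔ y = ((h * x.out : G) : G ⧸ K) := fun y => by
    conv_rhs => rw [← QuotientGroup.out_eq' y]
    rw [QuotientGroup.eq, mul_assoc]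
  have hm : (((h * x.out : G) : G ⧸ K)).out⁻¹ * h * x.out ∈ K := (hy _).2 rfl
  rw [Finset.sum_eq_single ((h * x.out : G) : G ⧸ K)]
  · simp only [monomialMatrix, dif_pos hm]
    have hiff : z.out⁻¹ * (g * h) * x.out ∈ K ↔
        z.out⁻¹ * g * (((h * x.out : G) : G ⧸ K)).out ∈ K := by
      rw [← Subgroup.mul_mem_cancel_right K (y := z.out⁻¹ * g * _) hm]
      simp [mul_assoc]
    by_cases hk : z.out⁻¹ * (g * h) * x.out ∈ K
    · rw [dif_pos hk, dif_pos (hiff.1 hk), ← map_mul]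
      congr 1
      ext
      simp [mul_assoc]
    · rw [dif_neg hk, dif_neg (hiff.not.1 hk), zero_mul]
  · intro y _ hne
    simp only [monomialMatrix]
    rw [dif_neg ((hy y).not.2 hne), mul_zero]
  · simp

theorem monomialMatrix_one (K : Subgroup G) [DecidableEq (G ⧸ K)] (lam : K →* ℂ) :
    monomialMatrix K lam 1 = 1 := by
  ext y x
  have hm : y.out⁻¹ * 1 * x.out ∈ K ↔ y = x := by
    rw [mul_one, ← QuotientGroup.eq, QuotientGroup.out_eq', QuotientGroup.out_eq']
  by_cases h : y = x
  · subst h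
    simp only [monomialMatrix, dif_pos (hm.2 rfl), Matrix.one_apply_eq]
    rw [← map_one lam]
    congr 1
    ext
    simp
  · simp only [monomialMatrix, dif_neg (hm.not.2 h), Matrix.one_apply_ne h]

theorem trace_monomialMatrix [Finite G] (K : Subgroup G) [Fintype (G ⧸ K)] (lam : K →* ℂ) (g : G) :
    (monomialMatrix K lam g).trace = indChar K lam g := by
  classical
  let _ := Fintype.ofFinite G
  have hK : (Nat.card K : ℂ) ≠ 0 := by exact_mod_cast Nat.card_pos.ne'
  -- Conjugation by an element of `K` does not change the summand of the induced character.
  have hconst : ∀ x : G, (if h : x⁻¹ * g * x ∈ K then lam ⟨x⁻¹ * g * x, h⟩ else 0) =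
      monomialMatrix K lam g (x : G ⧸ K) (x : G ⧸ K) := fun x => by
    obtain ⟨k, hk⟩ := QuotientGroup.mk_out_eq_mul K x
    simp only [monomialMatrix, hk]
    have hiff : x⁻¹ * g * x ∈ K ↔ (x * k)⁻¹ * g * (x * k) ∈ K := by
      rw [← Subgroup.mul_mem_cancel_right K k.2, ← Subgroup.mul_mem_cancel_left K (inv_mem k.2)]
      simp [mul_assoc]
    by_cases h : x⁻¹ * g * x ∈ K
    · rw [dif_pos h, dif_pos (hiff.1 h)]
      have he : (⟨_, hiff.1 h⟩ : K) = k⁻¹ * ⟨_, h⟩ * k := by ext; simp [mul_assoc]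
      have h1 : lam k⁻¹ * lam k = 1 := by rw [← map_mul, inv_mul_cancel, map_one]
      rw [he, map_mul, map_mul, mul_right_comm, h1, one_mul]
    · rw [dif_neg h, dif_neg (hiff.not.1 h)]
  have hsum : ∑ x : G, monomialMatrix K lam g (x : G ⧸ K) (x : G ⧸ K) =
      Nat.card K * ∑ y : G ⧸ K, monomialMatrix K lam g y y := by
    rw [← Finset.sum_fiberwise Finset.univ (fun x : G => (x : G ⧸ K)), Finset.mul_sum]
    refine Finset.sum_congr rfl fun y _ => ?_
    rw [Finset.sum_congr rfl (g := fun _ => monomialMatrix K lam g y y)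
      (fun x hx => by rw [(Finset.mem_filter.1 hx).2]), Finset.sum_const, nsmul_eq_mul]
    congr 2
    rw [← Fintype.card_subtype, ← Nat.card_eq_fintype_card]
    obtain ⟨z, rfl⟩ := QuotientGroup.mk_surjective y
    exact Nat.card_congr (QuotientGroup.preimageMkEquivSubgroupProdSet K {(z : G ⧸ K)}) |>.trans
      (by simp)
  simp only [indChar, Matrix.trace, Matrix.diag_apply]
  rw [Finset.sum_congr rfl fun x _ => hconst x, hsum, inv_mul_cancel_left₀ hK]

/-- The character of `G` induced from a linear character of a subgroup is irreducible as soon as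
its norm is one. -/
theorem isIrrChar_indChar [Finite G] (K : Subgroup G) (lam : K →* ℂ)
    (h : charInner (indChar K lam) (indChar K lam) = 1) : IsIrrChar (indChar K lam) := by
  classical
  let _ := Fintype.ofFinite G
  let _ := Fintype.ofFinite (G ⧸ K)
  let M : G →* Matrix (G ⧸ K) (G ⧸ K) ℂ :=
    { toFun := monomialMatrix K lam
      map_one' := monomialMatrix_one K lam
      map_mul' := monomialMatrix_mul K lam }
  let n := Fintype.card (G ⧸ K)
  let e : (G ⧸ K) ≃ Fin n := Fintype.equivFin _
  let ρ : Representation ℂ G (Fin n → ℂ) :=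
    (((Matrix.toLinAlgEquiv' (R := ℂ) (n := Fin n)) : Matrix (Fin n) (Fin n) ℂ →* _).comp
      ((Matrix.reindexAlgEquiv ℂ ℂ e : Matrix _ _ ℂ ≃ₐ[ℂ] _) :
        Matrix (G ⧸ K) (G ⧸ K) ℂ →* Matrix (Fin n) (Fin n) ℂ)).comp M
  have hρ : ρ.character = indChar K lam := by
    ext g
    rw [← trace_monomialMatrix]
    change LinearMap.trace ℂ _ (Matrix.toLin' (Matrix.reindex e e (monomialMatrix K lam g))) = _
    rw [Matrix.trace_toLin'_eq]
    exact Equiv.sum_comp e.symm fun y => monomialMatrix K lam g y y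
  refine ⟨n, ρ, isIrreducible_of_finrank_eq_one ρ ?_, hρ⟩
  have hinv : Invertible (Nat.card G : ℂ) :=
    invertibleOfNonzero (by exact_mod_cast Nat.card_pos.ne')
  have hfr := Representation.card_inv_mul_sum_char_mul_char_eq_finrank ρ ρ
  have hconj : ∀ g, indChar K lam g⁻¹ = conj (indChar K lam g) := fun g => by
    simp only [indChar, map_mul, map_inv₀, map_sum, Complex.conj_natCast]
    congr 1
    refine Finset.sum_congr rfl fun x _ => ?_
    have hx : x⁻¹ * g⁻¹ * x = (x⁻¹ * g * x)⁻¹ := by group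
    by_cases hk : x⁻¹ * g * x ∈ K
    · rw [dif_pos hk, dif_pos (hx ▸ inv_mem hk), conj_monoidHom]
      congr 1
      ext
      exact hx
    · rw [dif_neg hk, dif_neg (by rw [hx, inv_mem_iff]; exact hk), map_zero]
  rw [hρ] at hfr
  simp only [hconj] at hfr
  rw [← Nat.cast_inj (R := ℂ), ← hfr, Nat.cast_one, ← h]
  rfl

theorem indChar_conj [Finite G] (H : Subgroup G) (φ : H → ℂ) (y g : G) :
    indChar H φ (y * g * y⁻¹) = indChar H φ g := by
  classical
  let _ := Fintype.ofFinite G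
  simp only [indChar]
  congr 1
  refine (Fintype.sum_equiv (Equiv.mulLeft y) _ _ fun x => ?_).symm
  have he : (y * x)⁻¹ * (y * g * y⁻¹) * (y * x) = x⁻¹ * g * x := by group
  simp only [Equiv.coe_mulLeft, he]

/-- Frobenius reciprocity. -/
theorem charInner_indChar [Finite G] (H : Subgroup G) (φ : H → ℂ) (χ : G → ℂ)
    (hχ : ∀ y g, χ (y * g * y⁻¹) = χ g) :
    charInner (indChar H φ) χ = charInner φ (resChar H χ) := by
  classical
  let _ := Fintype.ofFinite G
  let _ := Fintype.ofFinite H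
  have hG : (Nat.card G : ℂ) ≠ 0 := by exact_mod_cast Nat.card_pos.ne'
  simp only [charInner, indChar, resChar, mul_assoc, Finset.sum_mul, ← Finset.mul_sum]
  rw [Finset.sum_comm]
  have hx : ∀ x : G, ∑ g : G, (if h : x⁻¹ * (g * x) ∈ H then φ ⟨_, h⟩ else 0) * conj (χ g) =
      ∑ k : H, φ k * conj (χ k) := fun x => by
    rw [Fintype.sum_equiv (MulAut.conj x⁻¹).toEquiv _
      (fun g => (if h : g ∈ H then φ ⟨g, h⟩ else 0) * conj (χ g)) fun g => ?_]
    · rw [← Finset.sum_filter_of_ne (p := (· ∈ H)) (fun g _ hg => by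
        by_contra h
        exact hg (by rw [dif_neg h, zero_mul]))]
      rw [Finset.sum_subtype (p := (· ∈ H)) _ (fun g => by simp)]
      exact Finset.sum_congr rfl fun k _ => by rw [dif_pos k.2]
    · have hg : (MulAut.conj x⁻¹).toEquiv g = x⁻¹ * (g * x) := by simp [mul_assoc]
      have hc := hχ x⁻¹ g
      rw [inv_inv, mul_assoc] at hc
      rw [hg, hc]
  simp only [hx, Finset.sum_const, Finset.card_univ, nsmul_eq_mul, ← Nat.card_eq_fintype_card]
  field_simp

/-- The linear characters `lam` of `K` and `mu` of `B ≤ G` agree on `K ∩ x B x⁻¹`, where `K` maps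
to `G` by `ι`. -/
def AgreeAt {K : Type*} [Group K] (ι : K →* G) (B : Subgroup G) (lam : K →* ℂ) (mu : B →* ℂ)
    (x : G) : Prop :=
  ∀ k, ∀ h : x⁻¹ * ι k * x ∈ B, lam k = mu ⟨_, h⟩

section Mackey

variable {K : Type*} [Group K] {ι : K →* G} {B : Subgroup G} {lam : K →* ℂ} {mu : B →* ℂ}

/-- Agreement at `x` depends only on the double coset `K x B`. -/
theorem AgreeAt.of_mul {x : G} {k : K} {b : B} (h : AgreeAt ι B lam mu (ι k * x * b)) :
    AgreeAt ι B lam mu x := by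
  intro k' hk'
  have he : (ι k * x * b)⁻¹ * ι (k * k' * k⁻¹) * (ι k * x * b) =
      ((b⁻¹ * ⟨_, hk'⟩ * b : B) : G) := by
    simp [mul_assoc]
  have h1 := h (k * k' * k⁻¹) (he ▸ Subtype.mem _)
  have h2 : lam k * lam k⁻¹ = 1 := by rw [← map_mul, mul_inv_cancel, map_one]
  have h3 : mu b⁻¹ * mu b = 1 := by rw [← map_mul, inv_mul_cancel, map_one]
  rw [map_mul, map_mul, mul_right_comm, h2, one_mul] at h1
  rw [h1]
  have h4 : (⟨_, he ▸ Subtype.mem _⟩ : B) = b⁻¹ * ⟨_, hk'⟩ * b := Subtype.ext he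
  rw [h4, map_mul, map_mul, mul_right_comm, h3, one_mul]

theorem AgreeAt.mul {x : G} (h : AgreeAt ι B lam mu x) (k : K) (b : B) :
    AgreeAt ι B lam mu (ι k * x * b) := by
  refine AgreeAt.of_mul (k := k⁻¹) (b := b⁻¹) ?_
  simpa [mul_assoc] using h

/-- The contribution of one `x` to Mackey's formula. -/
theorem sum_mackey [Fintype K] [Finite G] (x : G) [DecidablePred (· ∈ B)]
    [Decidable (AgreeAt ι B lam mu x)] :
    ∑ k : K, lam k * conj (if h : x⁻¹ * ι k * x ∈ B then mu ⟨_, h⟩ else 0) =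
      if AgreeAt ι B lam mu x then ((Finset.univ.filter fun k => x⁻¹ * ι k * x ∈ B).card : ℂ)
      else 0 := by
  split_ifs with hx
  · rw [Finset.card_filter, Nat.cast_sum]
    refine Finset.sum_congr rfl fun k _ => ?_
    by_cases h : x⁻¹ * ι k * x ∈ B
    · rw [dif_pos h, if_pos h, hx k h, conj_monoidHom, ← map_mul, mul_inv_cancel, map_one,
        Nat.cast_one]
    · rw [dif_neg h, if_neg h, map_zero, mul_zero, Nat.cast_zero]
  · simp only [AgreeAt, not_forall] at hx
    obtain ⟨k₀, h₀, hne⟩ := hx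
    set c := lam k₀ * conj (mu ⟨_, h₀⟩) with hc
    -- Translation by `k₀` multiplies the sum by `c ≠ 1`.
    have hmul : ∀ k, lam (k₀ * k) *
        conj (if h : x⁻¹ * ι (k₀ * k) * x ∈ B then mu ⟨_, h⟩ else 0) =
        c * (lam k * conj (if h : x⁻¹ * ι k * x ∈ B then mu ⟨_, h⟩ else 0)) := fun k => by
      have he : x⁻¹ * ι (k₀ * k) * x = (x⁻¹ * ι k₀ * x) * (x⁻¹ * ι k * x) := by
        simp [mul_assoc]
      have hiff : x⁻¹ * ι (k₀ * k) * x ∈ B ↔ x⁻¹ * ι k * x ∈ B := by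
        rw [he, Subgroup.mul_mem_cancel_left B h₀]
      by_cases h : x⁻¹ * ι k * x ∈ B
      · rw [dif_pos h, dif_pos (hiff.2 h), hc]
        have h4 : (⟨_, hiff.2 h⟩ : B) = ⟨_, h₀⟩ * ⟨_, h⟩ := Subtype.ext he
        rw [h4, map_mul, map_mul, map_mul]
        ring
      · rw [dif_neg h, dif_neg (hiff.not.2 h)]
        simp
    have hs := Fintype.sum_equiv (Equiv.mulLeft k₀) _
      (fun k => lam k * conj (if h : x⁻¹ * ι k * x ∈ B then mu ⟨_, h⟩ else 0))
      fun k => (hmul k).symm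
    rw [← Finset.mul_sum] at hs
    by_contra hS
    refine hne ?_
    have hc1 : c = 1 := mul_right_cancel₀ hS (by rw [hs, one_mul])
    have hn : conj (mu ⟨_, h₀⟩) * mu ⟨_, h₀⟩ = 1 := by
      rw [conj_monoidHom, ← map_mul, inv_mul_cancel, map_one]
    calc lam k₀ = lam k₀ * (conj (mu ⟨_, h₀⟩) * mu ⟨_, h₀⟩) := by rw [hn, mul_one]
      _ = c * mu ⟨_, h₀⟩ := (mul_assoc _ _ _).symm
      _ = mu ⟨_, h₀⟩ := by rw [hc1, one_mul]

/-- Mackey's intertwining number formula: if `S` represents the double cosets in `K \ G / B` on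
which `lam` and `mu` agree, then `lam` has multiplicity `#S` in the pullback to `K` of the character
induced from `mu`. -/
theorem charInner_comp_indChar [Finite K] [Finite G] (S : Finset G)
    (hS : ∀ s ∈ S, AgreeAt ι B lam mu s)
    (hcover : ∀ x, AgreeAt ι B lam mu x → ∃ s ∈ S, ∃ k, ∃ b : B, x = ι k * s * b)
    (hinj : ∀ s ∈ S, ∀ s' ∈ S, ∀ k, ∀ b : B, s' = ι k * s * b → s = s') :
    charInner lam (fun k => indChar B mu (ι k)) = S.card := by
  classical
  let _ := Fintype.ofFinite G
  let _ := Fintype.ofFinite K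
  have hK : (Nat.card K : ℂ) ≠ 0 := by exact_mod_cast Nat.card_pos.ne'
  have hB : (Nat.card B : ℂ) ≠ 0 := by exact_mod_cast Nat.card_pos.ne'
  -- The number of ways to write an element of `K s B` as `k s b` is `|K ∩ x B x⁻¹|`.
  have hfib : ∀ x, (if AgreeAt ι B lam mu x then
      (Finset.univ.filter fun k => x⁻¹ * ι k * x ∈ B).card else 0) =
      ∑ s ∈ S, (Finset.univ.filter fun k => x⁻¹ * ι k * s ∈ B).card := fun x => by
    split_ifs with hx
    · obtain ⟨s, hs, k₀, b₀, rfl⟩ := hcover x hx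
      rw [Finset.sum_eq_single s]
      · refine Finset.card_equiv (Equiv.mulRight k₀) fun k => ?_
        simp only [Finset.mem_filter, Finset.mem_univ, true_and, Equiv.coe_mulRight]
        rw [← Subgroup.mul_mem_cancel_right B b₀.2 (y := _ * ι (k * k₀) * s)]
        simp [mul_assoc]
      · intro s' hs' hne
        rw [Finset.card_eq_zero, Finset.filter_eq_empty_iff]
        intro k _ hk
        refine hne (hinj s hs s' hs' (k⁻¹ * k₀) (b₀ * ⟨_, hk⟩) ?_).symm
        simp [mul_assoc]
      · exact fun h => absurd hs h
    · symm
      refine Finset.sum_eq_zero fun s hs => ?_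
      rw [Finset.card_eq_zero, Finset.filter_eq_empty_iff]
      intro k _ hk
      refine hx (AgreeAt.of_mul (k := k⁻¹) (b := ⟨_, hk⟩) ?_)
      simpa [mul_assoc] using hS s hs
  have hcount : ∀ s k, ∑ x : G, (if x⁻¹ * ι k * s ∈ B then 1 else 0) = Nat.card B := fun s k => by
    rw [← Finset.card_filter, ← Fintype.card_subtype, ← Nat.card_eq_fintype_card]
    refine Nat.card_congr (((Equiv.inv G).trans (Equiv.mulRight (ι k * s))).subtypeEquiv ?_)
    intro x
    simp [mul_assoc]
  calc charInner lam (fun k => indChar B mu (ι k))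
      = (Nat.card K : ℂ)⁻¹ * ((Nat.card B : ℂ)⁻¹ * ∑ x : G, ∑ k : K,
          lam k * conj (if h : x⁻¹ * ι k * x ∈ B then mu ⟨_, h⟩ else 0)) := by
        simp only [charInner, indChar, map_mul, map_inv₀, map_sum, Complex.conj_natCast]
        rw [Finset.sum_comm, Finset.mul_sum (a := (Nat.card B : ℂ)⁻¹)]
        congr 1
        refine Finset.sum_congr rfl fun k _ => ?_
        rw [Finset.mul_sum, Finset.mul_sum, Finset.mul_sum]
        exact Finset.sum_congr rfl fun x _ => by ring
    _ = (Nat.card K : ℂ)⁻¹ * ((Nat.card B : ℂ)⁻¹ *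
          ((S.card * (Nat.card K * Nat.card B) : ℕ) : ℂ)) := by
        congr 2
        have h1 : ∑ x : G, (if AgreeAt ι B lam mu x then
            (Finset.univ.filter fun k => x⁻¹ * ι k * x ∈ B).card else 0) =
            S.card * (Nat.card K * Nat.card B) := by
          rw [Finset.sum_congr rfl fun x _ => hfib x, Finset.sum_comm]
          simp only [Finset.card_filter]
          rw [Finset.sum_congr rfl fun s _ => Finset.sum_comm]
          simp [hcount]
        rw [← h1, Nat.cast_sum]
        refine Finset.sum_congr rfl fun x _ => ?_
        rw [sum_mackey]
        split_ifs <;> simp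
    _ = S.card := by
        push_cast
        field_simp

end Mackey

/-- An irreducible character remains irreducible when pulled back along an isomorphism. -/
theorem IsIrrChar.comp_equiv {G' : Type*} [Group G'] {χ : G' → ℂ} (h : IsIrrChar χ)
    (φ : G ≃* G') : IsIrrChar fun g => χ (φ g) := by
  obtain ⟨n, ρ, hρ, rfl⟩ := h
  refine ⟨n, ρ.comp φ.toMonoidHom, ?_, rfl⟩
  let e : Subrepresentation ρ ≃o Subrepresentation (ρ.comp φ.toMonoidHom) :=
    { toFun := fun W => ⟨W.toSubmodule, fun g => W.apply_mem_toSubmodule (φ g)⟩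
      invFun := fun W => ⟨W.toSubmodule, fun g v hv => by
        simpa using W.apply_mem_toSubmodule (φ.symm g) hv⟩
      left_inv := fun _ => rfl
      right_inv := fun _ => rfl
      map_rel_iff' := Iff.rfl }
  exact e.isSimpleOrder_iff.1 hρ

/-- Being a strong Gelfand subgroup is preserved by isomorphisms of the ambient group. -/
theorem IsStrongGelfand.of_equiv {G' : Type*} [Group G'] [Finite G] [Finite G'] {H : Subgroup G}
    {H' : Subgroup G'} (φ : G ≃* G') (hφ : ∀ g, g ∈ H ↔ φ g ∈ H') (h : IsStrongGelfand H) :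
    IsStrongGelfand H' := by
  classical
  let _ := Fintype.ofFinite G
  let _ := Fintype.ofFinite G'
  intro ψ hψ χ hχ
  have hmap : H.map φ.toMonoidHom = H' := by
    ext g
    constructor
    · rintro ⟨x, hx, rfl⟩
      exact (hφ x).1 hx
    · exact fun hg => ⟨φ.symm g, (hφ _).2 (by simpa using hg), by simp⟩
  subst hmap
  let φH : H ≃* H.map φ.toMonoidHom := H.equivMapOfInjective φ.toMonoidHom φ.injective
  have h1 := h _ (hψ.comp_equiv φH) _ (hχ.comp_equiv φ)
  have hind : ∀ g, indChar H (fun k => ψ (φH k)) g = indChar (H.map φ.toMonoidHom) ψ (φ g) :=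
    fun g => by
      simp only [indChar, Nat.card_congr φH.toEquiv]
      congr 1
      refine Fintype.sum_equiv φ.toEquiv _ _ fun x => ?_
      have he : (φ x)⁻¹ * φ g * φ x = φ (x⁻¹ * g * x) := by simp
      by_cases hx : x⁻¹ * g * x ∈ H
      · have hx' : (φ x)⁻¹ * φ g * φ x ∈ H.map φ.toMonoidHom := he ▸ (hφ _).1 hx
        simp only [MulEquiv.toEquiv_eq_coe, EquivLike.coe_coe]
        rw [dif_pos hx, dif_pos hx']
        congr 1
        exact Subtype.ext he.symm
      · have hx' : (φ x)⁻¹ * φ g * φ x ∉ H.map φ.toMonoidHom := he ▸ (hφ _).not.1 hx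
        simp only [MulEquiv.toEquiv_eq_coe, EquivLike.coe_coe]
        rw [dif_neg hx, dif_neg hx']
  convert h1 using 2
  simp only [charInner, hind, Nat.card_congr φ.toEquiv]
  congr 1
  exact (Fintype.sum_equiv φ.toEquiv _ _ fun _ => rfl).symm

end Characters

/-! ### Elements and subgroups of the symplectic group -/

section Symplectic

variable {F : Type*} [Field F]

theorem coe_mul_mulVec (g h : Sp4 F) (v : Vec F) : (g * h).1 *ᵥ v = g.1 *ᵥ (h.1 *ᵥ v) := by
  rw [Submonoid.coe_mul, Matrix.mulVec_mulVec]

theorem one_mulVec_coe (v : Vec F) : (1 : Sp4 F).1 *ᵥ v = v := by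
  rw [Submonoid.coe_one, Matrix.one_mulVec]

theorem inv_mulVec_mulVec (g : Sp4 F) (v : Vec F) : g⁻¹.1 *ᵥ (g.1 *ᵥ v) = v := by
  rw [← coe_mul_mulVec, inv_mul_cancel, one_mulVec_coe]

theorem mulVec_inv_mulVec (g : Sp4 F) (v : Vec F) : g.1 *ᵥ (g⁻¹.1 *ᵥ v) = v := by
  rw [← coe_mul_mulVec, mul_inv_cancel, one_mulVec_coe]

/-- An element carrying `U` into a space `U'` of no larger dimension carries it onto `U'`. -/
theorem mem_iff_mulVec_mem {U U' : Submodule F (Vec F)} {g : Sp4 F}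
    (hle : ∀ v ∈ U, g.1 *ᵥ v ∈ U') (hfin : Module.finrank F U' ≤ Module.finrank F U) (v : Vec F) :
    v ∈ U ↔ g.1 *ᵥ v ∈ U' := by
  have hinj : Function.Injective g.1.mulVecLin :=
    Function.LeftInverse.injective (g := (g⁻¹).1.mulVecLin) (inv_mulVec_mulVec g)
  have hmap : U.map g.1.mulVecLin = U' := by
    refine Submodule.eq_of_le_of_finrank_le ?_ ?_
    · rintro _ ⟨u, hu, rfl⟩
      exact hle u hu
    · rwa [(Submodule.equivMapOfInjective _ hinj U).finrank_eq.symm]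
  rw [← hmap]
  exact (Function.Injective.mem_set_image hinj).symm

theorem mem_stab_iff {U : Submodule F (Vec F)} {g : Sp4 F} :
    g ∈ stab U ↔ ∀ u ∈ U, g.1 *ᵥ u ∈ U := by
  constructor
  · intro hg u hu
    have hmap : U.map g.1.mulVecLin = U := hg
    have := Submodule.mem_map_of_mem (f := g.1.mulVecLin) hu
    rwa [hmap] at this
  · intro h
    have hiff := mem_iff_mulVec_mem h le_rfl
    refine le_antisymm ?_ fun v hv => ⟨g⁻¹.1 *ᵥ v, (hiff _).2 ?_, mulVec_inv_mulVec g v⟩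
    · rintro _ ⟨u, hu, rfl⟩
      exact h u hu
    · rwa [mulVec_inv_mulVec]

theorem mem_stdLine_iff {v : Vec F} :
    v ∈ stdLine F ↔ v (.inl 1) = 0 ∧ v (.inr 0) = 0 ∧ v (.inr 1) = 0 := by
  rw [stdLine, Submodule.mem_span_singleton]
  constructor
  · rintro ⟨a, rfl⟩
    simp
  · rintro ⟨h1, h2, h3⟩
    refine ⟨v (.inl 0), ?_⟩
    ext (i | i) <;> fin_cases i <;> simp [*]

theorem mem_stdPlane_iff {v : Vec F} :
    v ∈ stdPlane F ↔ v (.inr 0) = 0 ∧ v (.inr 1) = 0 := by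
  rw [stdPlane, Submodule.mem_span_pair]
  constructor
  · rintro ⟨a, b, rfl⟩
    simp
  · rintro ⟨h2, h3⟩
    refine ⟨v (.inl 0), v (.inl 1), ?_⟩
    ext (i | i) <;> fin_cases i <;> simp [*]

theorem mem_stab_stdLine_iff {g : Sp4 F} :
    g ∈ stab (stdLine F) ↔ g.1 (.inl 1) (.inl 0) = 0 ∧ g.1 (.inr 0) (.inl 0) = 0 ∧
      g.1 (.inr 1) (.inl 0) = 0 := by
  rw [mem_stab_iff]
  constructor
  · intro h
    have := h (Pi.single (.inl 0) 1) (Submodule.subset_span rfl)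
    simpa [mem_stdLine_iff] using this
  · rintro ⟨h1, h2, h3⟩ u hu
    obtain ⟨a, rfl⟩ := Submodule.mem_span_singleton.1 hu
    simp [mem_stdLine_iff, Matrix.mulVec_smul, h1, h2, h3]

theorem mem_parabolicP_iff {g : Sp4 F} :
    g ∈ parabolicP F ↔ ∀ i j, g.1 (.inr i) (.inl j) = 0 := by
  refine ⟨lowerLeft_eq_zero, fun h => mem_stab_iff.2 fun u hu => ?_⟩
  obtain ⟨a, b, rfl⟩ := Submodule.mem_span_pair.1 hu
  simp [mem_stdPlane_iff, Matrix.mulVec_add, Matrix.mulVec_smul, h]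

theorem mem_borel_iff {g : Sp4 F} :
    g ∈ borel F ↔ g.1 (.inl 1) (.inl 0) = 0 ∧ ∀ i j, g.1 (.inr i) (.inl j) = 0 := by
  rw [borel, Subgroup.mem_inf, mem_stab_stdLine_iff]
  change _ ∧ g ∈ parabolicP F ↔ _
  rw [mem_parabolicP_iff]
  exact ⟨fun h => ⟨h.1.1, h.2⟩, fun h => ⟨⟨h.1, h.2 0 0, h.2 1 0⟩, h.2⟩⟩

theorem coe_mul_apply (g h : Sp4 F) (i j : Fin 2 ⊕ Fin 2) :
    (g * h).1 i j = g.1 i (.inl 0) * h.1 (.inl 0) j + g.1 i (.inl 1) * h.1 (.inl 1) j +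
      g.1 i (.inr 0) * h.1 (.inr 0) j + g.1 i (.inr 1) * h.1 (.inr 1) j := by
  rw [Submonoid.coe_mul, Matrix.mul_apply, Fintype.sum_sum_type]
  simp [Fin.sum_univ_two, add_assoc]

/-- The columns `(u₁, u₂; w₁, w₂)` and `(u₁', u₂'; w₁', w₂')` of the left half of a symplectic
matrix are orthogonal. -/
theorem cols_orthogonal (g : Sp4 F) :
    g.1 (.inl 0) (.inl 0) * g.1 (.inr 0) (.inl 1) + g.1 (.inl 1) (.inl 0) * g.1 (.inr 1) (.inl 1) =
    g.1 (.inl 0) (.inl 1) * g.1 (.inr 0) (.inl 0) +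
      g.1 (.inl 1) (.inl 1) * g.1 (.inr 1) (.inl 0) := by
  have h := g.2
  rw [← Matrix.fromBlocks_toBlocks g.1, SymplecticGroup.fromBlocks_mem_iff] at h
  have h1 := congrFun₂ h.1 0 1
  simp only [Matrix.mul_apply, Fin.sum_univ_two, Matrix.transpose_apply, Matrix.toBlocks₁₁,
    Matrix.toBlocks₂₁, Matrix.of_apply] at h1
  linear_combination h1

/-- If the first columns of `x` and `y` span the same flag then `x` and `y` lie in the same coset of
the Borel subgroup; the coefficients are the diagonal entries of `x⁻¹ y`. -/
theorem inv_mul_mem_borel {x y : Sp4 F} {α β c : F}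
    (h0 : ∀ i, y.1 i (.inl 0) = α * x.1 i (.inl 0))
    (h1 : ∀ i, y.1 i (.inl 1) = β * x.1 i (.inl 1) + c * x.1 i (.inl 0)) :
    x⁻¹ * y ∈ borel F ∧ blkA (x⁻¹ * y) 0 0 = α ∧ blkA (x⁻¹ * y) 1 1 = β := by
  have hone : ∀ i j, x⁻¹.1 i (.inl 0) * x.1 (.inl 0) j + x⁻¹.1 i (.inl 1) * x.1 (.inl 1) j +
      x⁻¹.1 i (.inr 0) * x.1 (.inr 0) j + x⁻¹.1 i (.inr 1) * x.1 (.inr 1) j =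
      if i = j then 1 else 0 := fun i j => by
    rw [← coe_mul_apply, inv_mul_cancel, Submonoid.coe_one, Matrix.one_apply]
  have e0 : ∀ i, (x⁻¹ * y).1 i (.inl 0) = α * if i = .inl 0 then 1 else 0 := fun i => by
    rw [← hone, coe_mul_apply]
    simp only [h0]
    ring
  have e1 : ∀ i, (x⁻¹ * y).1 i (.inl 1) = β * (if i = .inl 1 then 1 else 0) +
      c * if i = .inl 0 then 1 else 0 := fun i => by
    rw [← hone, ← hone, coe_mul_apply]
    simp only [h1]
    ring
  refine ⟨mem_borel_iff.2 ⟨by simp [e0], fun i j => ?_⟩, by simp [blkA, e0], by simp [blkA, e1]⟩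
  fin_cases j <;> simp [e0, e1]

/-- The unipotent element `(1 X; 0 1)` with `X = (a b; b c)`. -/
def upper (a b c : F) : Sp4 F :=
  ⟨Matrix.fromBlocks 1 !![a, b; b, c] 0 1, by
    rw [SymplecticGroup.fromBlocks_mem_iff]
    refine ⟨by simp, ?_, by simp⟩
    ext i j
    fin_cases i <;> fin_cases j <;> simp⟩

/-- The diagonal element `diag(t, s, t⁻¹, s⁻¹)`. -/
def torus (t s : Fˣ) : Sp4 F :=
  ⟨Matrix.fromBlocks !![(t : F), 0; 0, (s : F)] 0 0 !![((t⁻¹ : Fˣ) : F), 0; 0, ((s⁻¹ : Fˣ) : F)], by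
    rw [SymplecticGroup.fromBlocks_mem_iff]
    refine ⟨by simp, by simp, ?_⟩
    ext i j
    fin_cases i <;> fin_cases j <;> simp [Matrix.mul_apply, Fin.sum_univ_two]⟩

/-- The block diagonal element with upper left block `(1 a; 0 1)`. -/
def shear (a : F) : Sp4 F :=
  ⟨Matrix.fromBlocks !![1, a; 0, 1] 0 0 !![1, 0; -a, 1], by
    rw [SymplecticGroup.fromBlocks_mem_iff]
    refine ⟨by simp, by simp, ?_⟩
    ext i j
    fin_cases i <;> fin_cases j <;> simp [Matrix.mul_apply, Fin.sum_univ_two]⟩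

/-- The Weyl group element exchanging `e₁, e₂` and `f₁, f₂`. -/
def weylSwap : Sp4 F :=
  ⟨Matrix.fromBlocks !![0, 1; 1, 0] 0 0 !![0, 1; 1, 0], by
    rw [SymplecticGroup.fromBlocks_mem_iff]
    refine ⟨by simp, by simp, ?_⟩
    ext i j
    fin_cases i <;> fin_cases j <;> simp [Matrix.mul_apply, Fin.sum_univ_two]⟩

/-- The Weyl group element taking `e₁` to `f₁`, `f₁` to `-e₁`, and fixing `e₂`, `f₂`. -/
def weylFlip : Sp4 F :=
  ⟨Matrix.fromBlocks !![0, 0; 0, 1] !![-1, 0; 0, 0] !![1, 0; 0, 0] !![0, 0; 0, 1], by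
    rw [SymplecticGroup.fromBlocks_mem_iff]
    refine ⟨?_, ?_, ?_⟩ <;>
    · ext i j
      fin_cases i <;> fin_cases j <;> simp [Matrix.mul_apply, Fin.sum_univ_two]⟩

theorem upper_mulVec (a b c : F) (v : Vec F) :
    (upper a b c).1 *ᵥ v = Sum.elim
      ![v (.inl 0) + (a * v (.inr 0) + b * v (.inr 1)),
        v (.inl 1) + (b * v (.inr 0) + c * v (.inr 1))] ![v (.inr 0), v (.inr 1)] := by
  ext (i | i) <;> fin_cases i <;>
    simp [upper, Matrix.mulVec, dotProduct, Fin.sum_univ_two]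

theorem shear_mulVec (a : F) (v : Vec F) :
    (shear a).1 *ᵥ v = Sum.elim ![v (.inl 0) + a * v (.inl 1), v (.inl 1)]
      ![v (.inr 0), -a * v (.inr 0) + v (.inr 1)] := by
  ext (i | i) <;> fin_cases i <;>
    simp [shear, Matrix.mulVec, dotProduct, Fin.sum_univ_two]

theorem weylSwap_mulVec (v : Vec F) :
    weylSwap.1 *ᵥ v = Sum.elim ![v (.inl 1), v (.inl 0)] ![v (.inr 1), v (.inr 0)] := by
  ext (i | i) <;> fin_cases i <;>
    simp [weylSwap, Matrix.mulVec, dotProduct, Fin.sum_univ_two]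

theorem weylFlip_mulVec (v : Vec F) :
    weylFlip.1 *ᵥ v = Sum.elim ![-v (.inr 0), v (.inl 1)] ![v (.inl 0), v (.inr 1)] := by
  ext (i | i) <;> fin_cases i <;>
    simp [weylFlip, Matrix.mulVec, dotProduct, Fin.sum_univ_two]

theorem upper_mem_borel (a b c : F) : upper a b c ∈ borel F :=
  mem_borel_iff.2 ⟨by simp [upper], fun i j => by simp [upper]⟩

theorem torus_mem_borel (t s : Fˣ) : torus t s ∈ borel F :=
  mem_borel_iff.2 ⟨by simp [torus], fun i j => by simp [torus]⟩

theorem shear_mem_borel (a : F) : shear a ∈ borel F :=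
  mem_borel_iff.2 ⟨by simp [shear], fun i j => by simp [shear]⟩

/-- Every nonzero vector is carried by the Borel subgroup to a multiple of a basis vector. -/
theorem exists_borel_mulVec_eq_single {v : Vec F} (hv : v ≠ 0) :
    ∃ b ∈ borel F, ∃ r, ∃ c : F, c ≠ 0 ∧ b.1 *ᵥ v = Pi.single r c := by
  by_cases hw1 : v (.inr 0) = 0
  · by_cases hw2 : v (.inr 1) = 0
    · by_cases hu2 : v (.inl 1) = 0
      · refine ⟨1, one_mem _, .inl 0, v (.inl 0), fun hu1 => hv ?_, ?_⟩
        · ext (i | i) <;> fin_cases i <;> assumption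
        · ext (i | i) <;> fin_cases i <;> simp [*]
      · refine ⟨shear (-(v (.inl 0) / v (.inl 1))), shear_mem_borel _, .inl 1, v (.inl 1), hu2, ?_⟩
        rw [shear_mulVec]
        ext (i | i) <;> fin_cases i <;> simp [*]
    · refine ⟨upper 0 (-(v (.inl 0) / v (.inr 1))) (-(v (.inl 1) / v (.inr 1))),
        upper_mem_borel _ _ _, .inr 1, v (.inr 1), hw2, ?_⟩
      rw [upper_mulVec]
      ext (i | i) <;> fin_cases i <;> simp [*]
  · refine ⟨upper (-(v (.inl 0) + v (.inr 1) / v (.inr 0) * v (.inl 1)) / v (.inr 0))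
      (-(v (.inl 1) / v (.inr 0))) 0 * shear (v (.inr 1) / v (.inr 0)),
      mul_mem (upper_mem_borel _ _ _) (shear_mem_borel _), .inr 0, v (.inr 0), hw1, ?_⟩
    rw [Submonoid.coe_mul, ← Matrix.mulVec_mulVec, shear_mulVec, upper_mulVec]
    ext (i | i) <;> fin_cases i <;> simp [*]

/-- The alternating form in coordinates. -/
theorem dotProduct_J_mulVec (u v : Vec F) : u ⬝ᵥ (Matrix.J (Fin 2) F *ᵥ v) =
    u (.inr 0) * v (.inl 0) + u (.inr 1) * v (.inl 1) - u (.inl 0) * v (.inr 0) -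
      u (.inl 1) * v (.inr 1) := by
  simp [Matrix.J, Matrix.mulVec, dotProduct, Fin.sum_univ_two, Matrix.one_apply]
  ring

theorem dotProduct_J_mulVec_mulVec (g : Sp4 F) (u v : Vec F) :
    (g.1 *ᵥ u) ⬝ᵥ (Matrix.J (Fin 2) F *ᵥ (g.1 *ᵥ v)) = u ⬝ᵥ (Matrix.J (Fin 2) F *ᵥ v) := by
  have h := SymplecticGroup.mem_iff'.1 g.2
  conv_rhs => rw [← h]
  rw [← Matrix.vecMul_transpose, ← Matrix.dotProduct_mulVec, Matrix.mulVec_mulVec,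
    Matrix.mulVec_mulVec, Matrix.mul_assoc]

/-- The Bruhat decomposition, as a statement on flags: a flag of totally isotropic subspaces is
carried by the Borel subgroup to a flag spanned by basis vectors. As `Sum.swap` exchanges `eᵢ` and
`fᵢ`, the condition `r₂ ≠ r₁.swap` says that the basis vectors are orthogonal. -/
theorem exists_borel_mulVec_pair {v₁ v₂ : Vec F} (h₁ : v₁ ≠ 0) (h₂ : ∀ a : F, v₂ ≠ a • v₁)
    (h : v₁ ⬝ᵥ (Matrix.J (Fin 2) F *ᵥ v₂) = 0) :
    ∃ b ∈ borel F, ∃ r₁ r₂, ∃ c d c' : F, c ≠ 0 ∧ d ≠ 0 ∧ r₂ ≠ r₁ ∧ r₂ ≠ r₁.swap ∧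
      b.1 *ᵥ v₁ = Pi.single r₁ c ∧ b.1 *ᵥ v₂ = Pi.single r₂ d + Pi.single r₁ c' := by
  obtain ⟨b, hb, r₁, c, hc, hbv⟩ := exists_borel_mulVec_eq_single h₁
  -- It remains to move the second vector by the stabilizer of the first basis vector.
  suffices H : ∀ v : Vec F, (∀ a : F, v ≠ a • Pi.single r₁ c) →
      (Pi.single r₁ c) ⬝ᵥ (Matrix.J (Fin 2) F *ᵥ v) = 0 →
      ∃ b ∈ borel F, ∃ r₂, ∃ d c' : F, d ≠ 0 ∧ r₂ ≠ r₁ ∧ r₂ ≠ r₁.swap ∧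
      b.1 *ᵥ (Pi.single r₁ c) = Pi.single r₁ c ∧
      b.1 *ᵥ v = Pi.single r₂ d + Pi.single r₁ c' by
    obtain ⟨b', hb', r₂, d, c', hd, hr, hr', e₁, e₂⟩ := H (b.1 *ᵥ v₂) (fun a ha => h₂ a (by
      have h1 := congrArg (fun w => (b⁻¹).1 *ᵥ w) ha
      simpa only [← hbv, Matrix.mulVec_smul, inv_mulVec_mulVec] using h1))
      (by rw [← hbv, dotProduct_J_mulVec_mulVec, h])
    refine ⟨b' * b, mul_mem hb' hb, r₁, r₂, c, d, c', hc, hd, hr, hr', ?_, ?_⟩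
    · rw [Submonoid.coe_mul, ← Matrix.mulVec_mulVec, hbv, e₁]
    · rw [Submonoid.coe_mul, ← Matrix.mulVec_mulVec, e₂]
  intro v hv hω
  rw [dotProduct_J_mulVec] at hω
  have hne : ∀ r', (∀ r, r ≠ r₁ → r ≠ r' → v r = 0) → v r' ≠ 0 := fun r' h0 hr' =>
    hv (v r₁ / c) <| by
      ext r
      by_cases hr : r = r₁
      · subst hr
        simp [hc]
      · by_cases hrr : r = r'
        · simp [hr, hrr ▸ hr']
        · simp [hr, h0 r hr hrr]
  obtain rfl | rfl | rfl | rfl : r₁ = .inl 0 ∨ r₁ = .inl 1 ∨ r₁ = .inr 0 ∨ r₁ = .inr 1 := by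
    rcases r₁ with i | i <;> fin_cases i <;> simp
  · have hz : v (.inr 0) = 0 := by simpa [hc] using hω
    by_cases h0 : v (.inr 1) = 0
    · have hd := hne (.inl 1) (by rintro (i | i) <;> fin_cases i <;> simp [hz, h0])
      refine ⟨1, one_mem _, .inl 1, v (.inl 1), v (.inl 0), hd, by simp, by simp,
        one_mulVec_coe _, ?_⟩
      ext (i | i) <;> fin_cases i <;> simp [hz, h0]
    · refine ⟨upper 0 0 (-(v (.inl 1) / v (.inr 1))), upper_mem_borel _ _ _,
        .inr 1, v (.inr 1), v (.inl 0), h0, by simp, by simp, ?_, ?_⟩ <;>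
      · rw [upper_mulVec]
        ext (i | i) <;> fin_cases i <;> simp [hz, h0]
  · have hz : v (.inr 1) = 0 := by simpa [hc] using hω
    by_cases h0 : v (.inr 0) = 0
    · have hd := hne (.inl 0) (by rintro (i | i) <;> fin_cases i <;> simp [hz, h0])
      refine ⟨1, one_mem _, .inl 0, v (.inl 0), v (.inl 1), hd, by simp, by simp,
        one_mulVec_coe _, ?_⟩
      ext (i | i) <;> fin_cases i <;> simp [hz, h0]
    · refine ⟨upper (-(v (.inl 0) / v (.inr 0))) 0 0, upper_mem_borel _ _ _,
        .inr 0, v (.inr 0), v (.inl 1), h0, by simp, by simp, ?_, ?_⟩ <;>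
      · rw [upper_mulVec]
        ext (i | i) <;> fin_cases i <;> simp [hz, h0]
  · have hz : v (.inl 0) = 0 := by simpa [hc] using hω
    by_cases h0 : v (.inr 1) = 0
    · have hd := hne (.inl 1) (by rintro (i | i) <;> fin_cases i <;> simp [hz, h0])
      refine ⟨1, one_mem _, .inl 1, v (.inl 1), v (.inr 0), hd, by simp, by simp,
        one_mulVec_coe _, ?_⟩
      ext (i | i) <;> fin_cases i <;> simp [hz, h0]
    · refine ⟨upper 0 0 (-(v (.inl 1) / v (.inr 1))), upper_mem_borel _ _ _,
        .inr 1, v (.inr 1), v (.inr 0), h0, by simp, by simp, ?_, ?_⟩ <;>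
      · rw [upper_mulVec]
        ext (i | i) <;> fin_cases i <;> simp [hz, h0]
  · have hz : v (.inl 1) = 0 := by simpa [hc] using hω
    by_cases h0 : v (.inr 0) = 0
    · have hd := hne (.inl 0) (by rintro (i | i) <;> fin_cases i <;> simp [hz, h0])
      refine ⟨1, one_mem _, .inl 0, v (.inl 0), v (.inr 1), hd, by simp, by simp,
        one_mulVec_coe _, ?_⟩
      ext (i | i) <;> fin_cases i <;> simp [hz, h0]
    · refine ⟨upper (-(v (.inl 0) / v (.inr 0))) 0 0, upper_mem_borel _ _ _,
        .inr 0, v (.inr 0), v (.inr 1), h0, by simp, by simp, ?_, ?_⟩ <;>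
      · rw [upper_mulVec]
        ext (i | i) <;> fin_cases i <;> simp [hz, h0]

theorem mem_stab_iff_conj {U U' : Submodule F (Vec F)} {g : Sp4 F}
    (hU : ∀ v, v ∈ U ↔ g.1 *ᵥ v ∈ U') (h : Sp4 F) : h ∈ stab U ↔ MulAut.conj g h ∈ stab U' := by
  rw [mem_stab_iff, mem_stab_iff, MulAut.conj_apply]
  constructor
  · intro H u hu
    rw [coe_mul_mulVec, coe_mul_mulVec]
    exact (hU _).1 (H _ ((hU _).2 (by rwa [mulVec_inv_mulVec])))
  · intro H u hu
    have h1 := H _ ((hU u).1 hu)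
    rw [coe_mul_mulVec, coe_mul_mulVec, inv_mulVec_mulVec] at h1
    exact (hU _).2 h1

/-- `Sp₄(F)` is transitive on lines. -/
theorem exists_mem_iff_mem_stdLine {U : Submodule F (Vec F)} (hU : Module.finrank F U = 1) :
    ∃ g : Sp4 F, ∀ v, v ∈ U ↔ g.1 *ᵥ v ∈ stdLine F := by
  obtain ⟨u, hu0, hu⟩ := finrank_eq_one_iff'.1 hU
  have hu' : u.1 ≠ 0 := fun h => hu0 (Subtype.ext h)
  obtain ⟨b, -, r, c, -, hbu⟩ := exists_borel_mulVec_eq_single hu'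
  obtain ⟨w, hw⟩ : ∃ w : Sp4 F, w.1 *ᵥ (Pi.single r c) ∈ stdLine F := by
    obtain rfl | rfl | rfl | rfl : r = .inl 0 ∨ r = .inl 1 ∨ r = .inr 0 ∨ r = .inr 1 := by
      rcases r with i | i <;> fin_cases i <;> simp
    · exact ⟨1, by rw [one_mulVec_coe]; simp [mem_stdLine_iff]⟩
    · exact ⟨weylSwap, by rw [weylSwap_mulVec]; simp [mem_stdLine_iff]⟩
    · exact ⟨weylFlip, by rw [weylFlip_mulVec]; simp [mem_stdLine_iff]⟩
    · refine ⟨weylFlip * weylSwap, ?_⟩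
      rw [coe_mul_mulVec, weylSwap_mulVec, weylFlip_mulVec]
      simp [mem_stdLine_iff]
  refine ⟨w * b, mem_iff_mulVec_mem (fun v hv => ?_) ?_⟩
  · obtain ⟨a, ha⟩ := hu ⟨v, hv⟩
    have hav : v = a • u.1 := (congrArg Subtype.val ha).symm
    rw [hav, Matrix.mulVec_smul, coe_mul_mulVec, hbu]
    exact Submodule.smul_mem _ _ hw
  · rw [hU, stdLine, finrank_span_singleton (by simp)]

/-- `Sp₄(F)` is transitive on totally isotropic planes. -/
theorem exists_mem_iff_mem_stdPlane {U : Submodule F (Vec F)} (hU : Module.finrank F U = 2)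
    (hiso : IsTotallyIsotropic U) : ∃ g : Sp4 F, ∀ v, v ∈ U ↔ g.1 *ᵥ v ∈ stdPlane F := by
  classical
  let u : Module.Basis (Fin 2) F U := Module.finBasisOfFinrankEq F U hU
  have hli := u.linearIndependent
  rw [linearIndependent_fin2] at hli
  obtain ⟨b, -, r₁, r₂, c, d, c', -, -, hr, hr', e₁, e₂⟩ := exists_borel_mulVec_pair
    (v₁ := (u 1 : Vec F)) (v₂ := (u 0 : Vec F)) (fun h => hli.1 (Subtype.ext h))
    (fun a h => hli.2 a (Subtype.ext h.symm)) (hiso _ (u 1).2 _ (u 0).2)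
  obtain ⟨w, hw⟩ : ∃ w : Sp4 F, ∀ x : F, w.1 *ᵥ (Pi.single r₁ x) ∈ stdPlane F ∧
      w.1 *ᵥ (Pi.single r₂ x) ∈ stdPlane F := by
    have hex : ∀ s₁ s₂ : Fin 2 ⊕ Fin 2, s₂ ≠ s₁ → s₂ ≠ s₁.swap → ∃ w : Sp4 F, ∀ x : F,
        w.1 *ᵥ (Pi.single s₁ x) ∈ stdPlane F ∧ w.1 *ᵥ (Pi.single s₂ x) ∈ stdPlane F := by
      -- The four planes spanned by basis vectors.
      have h1 : ∀ x : F, ∀ i, (1 : Sp4 F).1 *ᵥ Pi.single (.inl i) x ∈ stdPlane F := fun x i => by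
        rw [one_mulVec_coe]; simp [mem_stdPlane_iff]
      have h2 : ∀ x : F, weylFlip.1 *ᵥ Pi.single (.inr 0) x ∈ stdPlane F ∧
          weylFlip.1 *ᵥ Pi.single (.inl 1) x ∈ stdPlane F := fun x => by
        simp only [weylFlip_mulVec]; simp [mem_stdPlane_iff]
      have h3 : ∀ x : F, (weylFlip * weylSwap).1 *ᵥ Pi.single (.inr 1) x ∈ stdPlane F ∧
          (weylFlip * weylSwap).1 *ᵥ Pi.single (.inl 0) x ∈ stdPlane F := fun x => by
        simp only [coe_mul_mulVec, weylSwap_mulVec, weylFlip_mulVec]; simp [mem_stdPlane_iff]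
      have h4 : ∀ x : F, ∀ i, (weylFlip * weylSwap * weylFlip).1 *ᵥ Pi.single (.inr i) x ∈
          stdPlane F := fun x i => by
        simp only [coe_mul_mulVec, weylSwap_mulVec, weylFlip_mulVec]
        fin_cases i <;> simp [mem_stdPlane_iff]
      rintro (i | i) (j | j) hne hne'
      · exact ⟨1, fun x => ⟨h1 x i, h1 x j⟩⟩
      · fin_cases i <;> fin_cases j
        · simp at hne'
        · exact ⟨_, fun x => (h3 x).symm⟩
        · exact ⟨_, fun x => (h2 x).symm⟩
        · simp at hne'
      · fin_cases i <;> fin_cases j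
        · simp at hne'
        · exact ⟨_, h2⟩
        · exact ⟨_, h3⟩
        · simp at hne'
      · exact ⟨_, fun x => ⟨h4 x i, h4 x j⟩⟩
    exact hex r₁ r₂ hr hr'
  refine ⟨w * b, mem_iff_mulVec_mem (fun v hv => ?_) ?_⟩
  · have hv' : v = u.repr ⟨v, hv⟩ 0 • (u 0).1 + u.repr ⟨v, hv⟩ 1 • (u 1).1 := by
      have := congrArg Subtype.val (u.sum_repr ⟨v, hv⟩)
      rw [Fin.sum_univ_two] at this
      exact this.symm
    rw [hv', Matrix.mulVec_add, Matrix.mulVec_smul, Matrix.mulVec_smul,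
      coe_mul_mulVec, coe_mul_mulVec, e₁, e₂, Matrix.mulVec_add]
    exact add_mem (Submodule.smul_mem _ _ (add_mem (hw _).2 (hw _).1))
      (Submodule.smul_mem _ _ (hw _).1)
  · rw [hU, stdPlane]
    have h := finrank_span_finset_le_card (R := F)
      ({Pi.single (.inl 0) 1, Pi.single (.inl 1) 1} : Finset (Vec F))
    rw [Finset.coe_pair] at h
    exact h.trans Finset.card_le_two

end Symplectic

/-! ### The principal series character -/

section PrincipalSeries

variable {F : Type*} [Field F]

/-- The linear character `g ↦ γ(A₁₁)ᵐ γ(A₂₂)ⁿ` of the Borel subgroup. -/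
def borelChar (γ : Fˣ →* ℂˣ) (m n : ℕ) : borel F →* ℂ where
  toFun g := MulChar.ofUnitHom γ (blkA (g : Sp4 F) 0 0) ^ m *
    MulChar.ofUnitHom γ (blkA (g : Sp4 F) 1 1) ^ n
  map_one' := by simp [blkA_one]
  map_mul' g h := by
    have h10 : blkA (h : Sp4 F) 1 0 = 0 := (mem_borel_iff.1 h.2).1
    have g10 : blkA (g : Sp4 F) 1 0 = 0 := (mem_borel_iff.1 g.2).1
    rw [Subgroup.coe_mul, blkA_mul h.2.2, blkA_mul h.2.2, h10, g10, mul_zero, add_zero, zero_mul,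
      zero_add, map_mul, map_mul]
    ring

theorem AgreeAt.eq_of_columns {K : Type*} [Group K] {ι : K →* Sp4 F} {lam : K →* ℂ}
    {γ : Fˣ →* ℂˣ} {m n : ℕ} {x : Sp4 F} (h : AgreeAt ι (borel F) lam (borelChar γ m n) x)
    (k : K) (α β : Fˣ) (c : F) (h0 : ∀ i, (ι k * x).1 i (.inl 0) = α * x.1 i (.inl 0))
    (h1 : ∀ i, (ι k * x).1 i (.inl 1) = β * x.1 i (.inl 1) + c * x.1 i (.inl 0)) :
    lam k = (γ α : ℂ) ^ m * (γ β : ℂ) ^ n := by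
  obtain ⟨hb, hα, hβ⟩ := inv_mul_mem_borel h0 h1
  rw [← mul_assoc] at hb hα hβ
  rw [h k hb]
  change MulChar.ofUnitHom γ (blkA _ 0 0) ^ m * MulChar.ofUnitHom γ (blkA _ 1 1) ^ n = _
  rw [hα, hβ, MulChar.ofUnitHom_coe, MulChar.ofUnitHom_coe]

/-- The characters of the diagonal torus on the basis vectors. -/
def torusWeight (t s : Fˣ) : Fin 2 ⊕ Fin 2 → Fˣ := Sum.elim ![t, s] ![t⁻¹, s⁻¹]

theorem torus_mul_apply (t s : Fˣ) (g : Sp4 F) (i j : Fin 2 ⊕ Fin 2) :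
    (torus t s * g).1 i j = torusWeight t s i * g.1 i j := by
  rw [coe_mul_apply]
  rcases i with i | i <;> fin_cases i <;> simp [torus, torusWeight]

theorem mulVec_col (g x : Sp4 F) (j : Fin 2 ⊕ Fin 2) (i) :
    (g.1 *ᵥ fun i => x.1 i j) i = (g * x).1 i j := by
  rw [Submonoid.coe_mul, Matrix.mul_apply]
  rfl

theorem col_inl_zero_ne_zero (x : Sp4 F) : (fun i => x.1 i (.inl 0)) ≠ 0 := fun h => by
  have h1 := mulVec_col x⁻¹ x (.inl 0) (.inl 0)
  rw [h, Matrix.mulVec_zero, inv_mul_cancel] at h1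
  simp at h1

theorem col_inl_one_ne_smul (x : Sp4 F) (a : F) :
    (fun i => x.1 i (.inl 1)) ≠ a • fun i => x.1 i (.inl 0) := fun h => by
  have h1 := mulVec_col x⁻¹ x (.inl 1) (.inl 1)
  rw [h, Matrix.mulVec_smul, Pi.smul_apply, mulVec_col, inv_mul_cancel] at h1
  simp at h1

/-- The weight `(1, 2)` has trivial stabilizer in the Weyl group when `Fˣ` has an element of order
at least seven; by the Bruhat decomposition the Borel subgroup is then the only double coset on
which the character of weight `(1, 2)` agrees with itself. -/
theorem mem_borel_of_agreeAt {γ : Fˣ →* ℂˣ} (hγ : Function.Injective γ) {z : Fˣ}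
    (hz : ∀ j, 1 ≤ j → j ≤ 6 → z ^ j ≠ 1) {x : Sp4 F}
    (h : AgreeAt (borel F).subtype (borel F) (borelChar γ 1 2) (borelChar γ 1 2) x) :
    x ∈ borel F := by
  obtain ⟨b, hb, r₁, r₂, c, d, c', hc, hd, hr, hr', e₁, e₂⟩ := exists_borel_mulVec_pair
    (col_inl_zero_ne_zero x) (col_inl_one_ne_smul x) (by
      rw [dotProduct_J_mulVec]
      linear_combination -cols_orthogonal x)
  have hy := h.mul ⟨b, hb⟩ 1
  rw [Subgroup.subtype_apply, Subgroup.coe_one, mul_one] at hy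
  have hy0 : ∀ i, (b * x).1 i (.inl 0) = (Pi.single r₁ c : Vec F) i := fun i => by
    rw [← mulVec_col, e₁]
  have hy1 : ∀ i, (b * x).1 i (.inl 1) = (Pi.single r₂ d + Pi.single r₁ c' : Vec F) i :=
    fun i => by rw [← mulVec_col, e₂]
  have key : ∀ t s : Fˣ, t * s ^ 2 = torusWeight t s r₁ * torusWeight t s r₂ ^ 2 := fun t s => by
    have h1 := hy.eq_of_columns ⟨torus t s, torus_mem_borel t s⟩ (torusWeight t s r₁)
      (torusWeight t s r₂) (c' * (torusWeight t s r₁ - torusWeight t s r₂) / c)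
      (fun i => by
        rw [Subgroup.subtype_apply, torus_mul_apply, hy0]
        by_cases hi : i = r₁
        · rw [hi]
        · simp [hi])
      (fun i => by
        rw [Subgroup.subtype_apply, torus_mul_apply, hy0, hy1]
        by_cases hi : i = r₁
        · subst hi
          simp [hr.symm]
          field_simp
          ring
        · by_cases hi2 : i = r₂
          · subst hi2
            simp [hi]
          · simp [hi, hi2])
    change MulChar.ofUnitHom γ (blkA (torus t s) 0 0) ^ 1 *
      MulChar.ofUnitHom γ (blkA (torus t s) 1 1) ^ 2 = _ at h1
    have ht : blkA (torus t s) 0 0 = t := by simp [torus, blkA]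
    have hs : blkA (torus t s) 1 1 = s := by simp [torus, blkA]
    rw [ht, hs, MulChar.ofUnitHom_coe, MulChar.ofUnitHom_coe] at h1
    refine hγ (Units.ext ?_)
    simpa using h1
  have k1 := key z 1
  have k2 := key 1 z
  have n1 : z ≠ z ^ 2 := fun h => hz 1 le_rfl (by norm_num)
    (by rw [pow_one]; exact mul_left_cancel (a := z) (by rw [mul_one, ← pow_two, ← h]))
  have n2 : z ≠ z⁻¹ := fun h => hz 2 (by norm_num) (by norm_num)
    (by rw [pow_two]; exact eq_inv_iff_mul_eq_one.1 h)
  have n3 : z ≠ (z ^ 2)⁻¹ := fun h => hz 3 (by norm_num) (by norm_num)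
    (by rw [pow_succ']; exact eq_inv_iff_mul_eq_one.1 h)
  have n4 : z ^ 2 ≠ (z ^ 2)⁻¹ := fun h => hz 4 (by norm_num) (by norm_num)
    (by rw [← eq_inv_iff_mul_eq_one.1 h, ← pow_add])
  have hbx : r₁ = .inl 0 ∧ r₂ = .inl 1 := by
    rcases r₁ with i | i <;> rcases r₂ with j | j <;> fin_cases i <;> fin_cases j <;>
      simp [torusWeight] at hr hr' k1 k2 ⊢
    · exact n1 k1
    · exact n4 k2
    · exact n3 k1
    · exact n2 k1
    · exact n1 k1
    · exact n2 k1
    · exact n3 k1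
  obtain ⟨rfl, rfl⟩ := hbx
  have hm : b * x ∈ borel F := mem_borel_iff.2 ⟨by simp [hy0], fun i j => by
    fin_cases j <;> simp [hy0, hy1]⟩
  simpa using mul_mem (inv_mem hb) hm

/-- If `lam` agrees with itself only on the trivial double coset then it induces irreducibly. -/
theorem isIrrChar_indChar_of_agreeAt {G : Type*} [Group G] [Finite G] (K : Subgroup G)
    (lam : K →* ℂ) (h : ∀ x, AgreeAt K.subtype K lam lam x → x ∈ K) :
    IsIrrChar (indChar K lam) := by
  refine isIrrChar_indChar K lam ?_
  rw [charInner_indChar _ _ _ (indChar_conj K lam)]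
  have h1 := charInner_comp_indChar (ι := K.subtype) (B := K) (lam := lam) (mu := lam) {1}
    (fun s hs k hk => by
      rw [Finset.mem_singleton] at hs
      subst hs
      congr 1
      ext
      simp)
    (fun x hx => ⟨1, by simp, ⟨x, h x hx⟩, 1, by simp⟩)
    (fun s hs s' hs' _ _ _ => by rw [Finset.mem_singleton.1 hs, Finset.mem_singleton.1 hs'])
  rwa [Finset.card_singleton, Nat.cast_one] at h1

/-- A finite field with more than four elements of characteristic two has a unit of order at least
seven. -/
theorem exists_unit_pow_ne_one [Fintype F] {e : ℕ} (he : 2 < e) (hq : Fintype.card F = 2 ^ e) :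
    ∃ z : Fˣ, ∀ j, 1 ≤ j → j ≤ 6 → z ^ j ≠ 1 := by
  classical
  obtain ⟨z, hz⟩ := IsCyclic.exists_generator (α := Fˣ)
  refine ⟨z, fun j h1 h6 hj => ?_⟩
  have ho : orderOf z = 2 ^ e - 1 := by
    rw [orderOf_eq_card_of_forall_mem_zpowers hz, Nat.card_eq_fintype_card, Fintype.card_units, hq]
  have h8 : 2 ^ 3 ≤ 2 ^ e := Nat.pow_le_pow_right (by norm_num) he
  have := Nat.le_of_dvd h1 (orderOf_dvd_of_pow_eq_one hj)
  omega

theorem isIrrChar_chi1 [Fintype F] {e : ℕ} (he : 2 < e) (hq : Fintype.card F = 2 ^ e)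
    {γ : Fˣ →* ℂˣ} (hγ : Function.Injective γ) : IsIrrChar (chi1 γ 1 2) := by
  obtain ⟨z, hz⟩ := exists_unit_pow_ne_one he hq
  exact isIrrChar_indChar_of_agreeAt (borel F) (borelChar γ 1 2)
    fun x hx => mem_borel_of_agreeAt hγ hz hx

end PrincipalSeries

/-! ### The characters of the parabolic subgroup -/

section Parabolic

variable {F : Type*} [Field F]

/-- The relations between the blocks of `(A B; 0 D) ∈ P`: `Aᵀ D = 1` and `Bᵀ D = Dᵀ B`. -/
theorem blocks_of_mem_parabolicP {g : Sp4 F} (hg : g ∈ parabolicP F) (i j : Fin 2) :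
    (g.1 (.inl 0) (.inl i) * g.1 (.inr 0) (.inr j) +
      g.1 (.inl 1) (.inl i) * g.1 (.inr 1) (.inr j) = if i = j then 1 else 0) ∧
    g.1 (.inl 0) (.inr i) * g.1 (.inr 0) (.inr j) +
      g.1 (.inl 1) (.inr i) * g.1 (.inr 1) (.inr j) =
      g.1 (.inr 0) (.inr i) * g.1 (.inl 0) (.inr j) +
      g.1 (.inr 1) (.inr i) * g.1 (.inl 1) (.inr j) := by
  have h := g.2
  rw [← Matrix.fromBlocks_toBlocks g.1, SymplecticGroup.fromBlocks_mem_iff] at h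
  have h1 := congrFun₂ h.2.1 i j
  have h2 := congrFun₂ h.2.2 i j
  simp only [Matrix.mul_apply, Fin.sum_univ_two, Matrix.transpose_apply, Matrix.toBlocks₁₂,
    Matrix.toBlocks₂₂, Matrix.toBlocks₁₁, Matrix.toBlocks₂₁, Matrix.of_apply, Matrix.sub_apply,
    lowerLeft_eq_zero hg, zero_mul, add_zero, sub_zero, Matrix.one_apply] at h1 h2
  exact ⟨h2, h1⟩

/-- The entries of `(A B; 0 D) ∈ P` with `A = diag(t, t⁻¹)`: `D = A⁻¹`, and `B D⁻¹` is symmetric. -/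
theorem entries_of_mem_hyperbolic (g : hyperbolicSubgroup F) :
    g.1.1.1 (.inl 0) (.inl 1) = 0 ∧ g.1.1.1 (.inl 1) (.inl 0) = 0 ∧
    g.1.1.1 (.inr 0) (.inr 1) = 0 ∧ g.1.1.1 (.inr 1) (.inr 0) = 0 ∧
    g.1.1.1 (.inr 0) (.inr 0) = g.1.1.1 (.inl 1) (.inl 1) ∧
    g.1.1.1 (.inr 1) (.inr 1) = g.1.1.1 (.inl 0) (.inl 0) ∧
    g.1.1.1 (.inl 0) (.inl 0) * g.1.1.1 (.inl 1) (.inl 1) = 1 ∧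
    g.1.1.1 (.inl 0) (.inr 1) * g.1.1.1 (.inl 1) (.inl 1) =
      g.1.1.1 (.inl 1) (.inr 0) * g.1.1.1 (.inl 0) (.inl 0) := by
  obtain ⟨h01, h10, hdet⟩ := g.2
  simp only [blkA] at h01 h10 hdet
  have b00 := (blocks_of_mem_parabolicP g.1.2 0 0).1
  have b01 := (blocks_of_mem_parabolicP g.1.2 0 1)
  have b10 := (blocks_of_mem_parabolicP g.1.2 1 0).1
  have b11 := (blocks_of_mem_parabolicP g.1.2 1 1).1
  simp only [h01, h10, zero_mul, add_zero, zero_add, reduceIte, zero_ne_one, one_ne_zero]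
    at b00 b01 b10 b11
  have n0 := left_ne_zero_of_mul_eq_one hdet
  have n1 := right_ne_zero_of_mul_eq_one hdet
  have d01 := (mul_eq_zero.1 b01.1).resolve_left n0
  have d10 := (mul_eq_zero.1 b10).resolve_left n1
  have d00 : g.1.1.1 (.inr 0) (.inr 0) = g.1.1.1 (.inl 1) (.inl 1) :=
    mul_left_cancel₀ n0 (b00.trans hdet.symm)
  have d11 : g.1.1.1 (.inr 1) (.inr 1) = g.1.1.1 (.inl 0) (.inl 0) :=
    mul_left_cancel₀ n1 (b11.trans (by rw [← hdet, mul_comm]))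
  refine ⟨h01, h10, d01, d10, d00, d11, hdet, ?_⟩
  have := b01.2
  rw [d01, d10, d00, d11] at this
  linear_combination -this

/-- The linear character `(1 X; 0 1) diag(t, t⁻¹, t⁻¹, t) ↦ γ(t)ᵏ ψ(X₁₂)` inducing `χ₅(k)`. -/
def hyperbolicChar (γ : Fˣ →* ℂˣ) (ψ : AddChar F ℂ) (k : ℕ) : hyperbolicSubgroup F →* ℂ where
  toFun g := MulChar.ofUnitHom γ (blkA (g : Sp4 F) 0 0) ^ k *
    ψ (blkB (g : Sp4 F) 0 1 * blkA (g : Sp4 F) 1 1)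
  map_one' := by simp [blkA_one, blkB]
  map_mul' g h := by
    obtain ⟨g01, g10, -, -, -, -, gdet, -⟩ := entries_of_mem_hyperbolic g
    obtain ⟨h01, h10, hd01, -, -, hd11, hdet, -⟩ := entries_of_mem_hyperbolic h
    have e0 : blkA (g.1.1 * h.1.1) 0 0 = blkA g.1.1 0 0 * blkA h.1.1 0 0 := by
      rw [blkA_mul h.1.2]
      simp only [blkA, h10]
      ring
    have e1 : blkB (g.1.1 * h.1.1) 0 1 * blkA (g.1.1 * h.1.1) 1 1 =
        blkB g.1.1 0 1 * blkA g.1.1 1 1 + blkB h.1.1 0 1 * blkA h.1.1 1 1 := by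
      rw [blkA_mul h.1.2]
      simp only [blkA, blkB, coe_mul_apply, h01, g01, g10, hd01, hd11]
      linear_combination g.1.1.1 (.inl 0) (.inr 1) * g.1.1.1 (.inl 1) (.inl 1) * hdet +
        h.1.1.1 (.inl 0) (.inr 1) * h.1.1.1 (.inl 1) (.inl 1) * gdet
    rw [Subgroup.coe_mul, Subgroup.coe_mul, e0, e1, map_mul, AddChar.map_add_eq_mul]
    ring

/-- The element `(1 X; 0 1) diag(t, t⁻¹, t⁻¹, t)` with `X = (a b; b c)`. -/
def hyperbolicElem (t : Fˣ) (a b c : F) : hyperbolicSubgroup F :=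
  ⟨⟨upper a b c * torus t t⁻¹, (mul_mem (upper_mem_borel a b c) (torus_mem_borel t t⁻¹)).2⟩, by
    refine ⟨?_, ?_, ?_⟩ <;> simp only [blkA, coe_mul_apply] <;> simp [upper, torus]⟩

theorem hyperbolicChar_hyperbolicElem (γ : Fˣ →* ℂˣ) (ψ : AddChar F ℂ) (k : ℕ) (t : Fˣ)
    (a b c : F) : hyperbolicChar γ ψ k (hyperbolicElem t a b c) = (γ t : ℂ) ^ k * ψ b := by
  change MulChar.ofUnitHom γ (blkA (upper a b c * torus t t⁻¹) 0 0) ^ k *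
    ψ (blkB (upper a b c * torus t t⁻¹) 0 1 * blkA (upper a b c * torus t t⁻¹) 1 1) = _
  have h0 : blkA (upper a b c * torus t t⁻¹) 0 0 = t := by
    simp only [blkA, coe_mul_apply]
    simp [upper, torus]
  have h1 : blkB (upper a b c * torus t t⁻¹) 0 1 * blkA (upper a b c * torus t t⁻¹) 1 1 = b := by
    simp only [blkA, blkB, coe_mul_apply]
    simp [upper, torus]
  rw [h0, h1, MulChar.ofUnitHom_coe]

/-- A nontrivial additive character of a field is trivial on no nonzero multiple of the field. -/
theorem eq_zero_of_forall_addChar_mul {ψ : AddChar F ℂ} (hψ : ψ ≠ 1) {m : F}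
    (h : ∀ a, ψ (m * a) = 1) : m = 0 := by
  by_contra hm
  exact hψ (by
    ext a
    have := h (m⁻¹ * a)
    rwa [mul_inv_cancel_left₀ hm] at this)

/-- The element of `Sp₄` underlying an element of the subgroup inducing `χ₅(k)`. -/
def hyperbolicHom : hyperbolicSubgroup F →* Sp4 F :=
  (parabolicP F).subtype.comp (hyperbolicSubgroup F).subtype

/-- The Levi factor of `P` acts on the unipotent radical by `X ↦ A X Aᵀ`. -/
theorem mul_upper (x : Sp4 F) (hx : x ∈ parabolicP F) (a b c : F) :
    x * upper a b c = upper
      (blkA x 0 0 ^ 2 * a + 2 * blkA x 0 0 * blkA x 0 1 * b + blkA x 0 1 ^ 2 * c)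
      (blkA x 0 0 * blkA x 1 0 * a + (blkA x 0 0 * blkA x 1 1 + blkA x 0 1 * blkA x 1 0) * b +
        blkA x 0 1 * blkA x 1 1 * c)
      (blkA x 1 0 ^ 2 * a + 2 * blkA x 1 0 * blkA x 1 1 * b + blkA x 1 1 ^ 2 * c) * x := by
  have h := fun i j => (blocks_of_mem_parabolicP hx i j).1
  have h00 := h 0 0
  have h01 := h 0 1
  have h10 := h 1 0
  have h11 := h 1 1
  simp only [reduceIte, zero_ne_one, one_ne_zero] at h00 h01 h10 h11
  have hl := lowerLeft_eq_zero hx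
  ext (i | i) (j | j) <;> rw [coe_mul_apply, coe_mul_apply] <;> fin_cases i <;> fin_cases j <;>
    simp [upper, blkA, hl]
  · linear_combination -(x.1 (.inl 0) (.inl 0) * a + x.1 (.inl 0) (.inl 1) * b) * h00 -
      (x.1 (.inl 0) (.inl 0) * b + x.1 (.inl 0) (.inl 1) * c) * h10
  · linear_combination -(x.1 (.inl 0) (.inl 0) * a + x.1 (.inl 0) (.inl 1) * b) * h01 -
      (x.1 (.inl 0) (.inl 0) * b + x.1 (.inl 0) (.inl 1) * c) * h11
  · linear_combination -(x.1 (.inl 1) (.inl 0) * a + x.1 (.inl 1) (.inl 1) * b) * h00 -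
      (x.1 (.inl 1) (.inl 0) * b + x.1 (.inl 1) (.inl 1) * c) * h10
  · linear_combination -(x.1 (.inl 1) (.inl 0) * a + x.1 (.inl 1) (.inl 1) * b) * h01 -
      (x.1 (.inl 1) (.inl 0) * b + x.1 (.inl 1) (.inl 1) * c) * h11

theorem upper_mem_hyperbolic (a b c : F) :
    (⟨upper a b c, (upper_mem_borel a b c).2⟩ : parabolicP F) ∈ hyperbolicSubgroup F :=
  ⟨by simp [blkA, upper], by simp [blkA, upper], by simp [blkA, upper]⟩

theorem hyperbolicChar_upper (γ : Fˣ →* ℂˣ) (ψ : AddChar F ℂ) (k : ℕ) (a b c : F) :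
    hyperbolicChar γ ψ k ⟨_, upper_mem_hyperbolic a b c⟩ = ψ b := by
  change MulChar.ofUnitHom γ (blkA (upper a b c) 0 0) ^ k *
    ψ (blkB (upper a b c) 0 1 * blkA (upper a b c) 1 1) = _
  have h0 : blkA (upper a b c) 0 0 = 1 := by simp [blkA, upper]
  have h1 : blkB (upper a b c) 0 1 * blkA (upper a b c) 1 1 = b := by simp [blkA, blkB, upper]
  rw [h0, h1, map_one, one_pow, one_mul]

/-- The elements of `P` on whose double coset the character inducing `χ₅(k)` agrees with itself: by
comparison on the unipotent radical, `A` stabilizes the quadratic form `x y`, and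
comparison on the torus rules out the interchange of its two isotropic lines. -/
theorem mem_hyperbolic_of_agreeAt {γ : Fˣ →* ℂˣ} (hγ : Function.Injective γ) {ψ : AddChar F ℂ}
    (hψ : ψ ≠ 1) {k : ℕ} {z : Fˣ} (hz : z ^ (2 * k) ≠ 1) {x : parabolicP F}
    (h : AgreeAt (hyperbolicSubgroup F).subtype (hyperbolicSubgroup F) (hyperbolicChar γ ψ k)
      (hyperbolicChar γ ψ k) x) :
    x ∈ hyperbolicSubgroup F := by
  have hψmul : ∀ a b c : F, ψ (blkA x.1 0 0 * blkA x.1 1 0 * a +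
      (blkA x.1 0 0 * blkA x.1 1 1 + blkA x.1 0 1 * blkA x.1 1 0) * b +
        blkA x.1 0 1 * blkA x.1 1 1 * c) = ψ b := fun a b c => by
    have he := mul_upper x.1 x.2 a b c
    set a' := blkA x.1 0 0 ^ 2 * a + 2 * blkA x.1 0 0 * blkA x.1 0 1 * b + blkA x.1 0 1 ^ 2 * c
    set b' := blkA x.1 0 0 * blkA x.1 1 0 * a + (blkA x.1 0 0 * blkA x.1 1 1 +
      blkA x.1 0 1 * blkA x.1 1 0) * b + blkA x.1 0 1 * blkA x.1 1 1 * c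
    set c' := blkA x.1 1 0 ^ 2 * a + 2 * blkA x.1 1 0 * blkA x.1 1 1 * b + blkA x.1 1 1 ^ 2 * c
    have he' : x⁻¹ * (⟨upper a' b' c', (upper_mem_borel _ _ _).2⟩ : parabolicP F) * x =
        ⟨upper a b c, (upper_mem_borel _ _ _).2⟩ := by
      rw [mul_assoc, inv_mul_eq_iff_eq_mul]
      exact Subtype.ext he.symm
    have h1 := h ⟨_, upper_mem_hyperbolic a' b' c'⟩ (by
      rw [Subgroup.subtype_apply, he']
      exact upper_mem_hyperbolic a b c)
    rw [hyperbolicChar_upper] at h1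
    rw [h1, ← hyperbolicChar_upper γ ψ k a b c]
    congr 1
    exact Subtype.ext he'
  have h0 : blkA x.1 0 0 * blkA x.1 1 0 = 0 := eq_zero_of_forall_addChar_mul hψ fun a => by
    simpa using hψmul a 0 0
  have h1 : blkA x.1 0 1 * blkA x.1 1 1 = 0 := eq_zero_of_forall_addChar_mul hψ fun c => by
    simpa using hψmul 0 0 c
  have h2 : blkA x.1 0 0 * blkA x.1 1 1 + blkA x.1 0 1 * blkA x.1 1 0 - 1 = 0 :=
    eq_zero_of_forall_addChar_mul hψ fun b => by
      rw [sub_mul, one_mul, AddChar.map_sub_eq_div]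
      have := hψmul 0 b 0
      rw [mul_zero, mul_zero, zero_add, add_zero] at this
      rw [this, div_self (ψ.val_isUnit b).ne_zero]
  by_cases hA : blkA x.1 0 0 = 0
  · exfalso
    rw [hA, zero_mul, zero_add, sub_eq_zero] at h2
    have n01 := left_ne_zero_of_mul_eq_one h2
    have n10 := right_ne_zero_of_mul_eq_one h2
    have hD := (mul_eq_zero.1 h1).resolve_left n01
    -- Conjugation by `x` inverts the torus; the corresponding character value is still `γ(z)ᵏ`.
    let τ : parabolicP F := ⟨torus z⁻¹ z, (torus_mem_borel _ _).2⟩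
    let κ := x * τ * x⁻¹
    have hκx : κ.1 * x.1 = x.1 * torus z⁻¹ z :=
      congrArg Subtype.val (by simp [κ, τ] : κ * x = x * τ)
    have hent : ∀ i j, (κ.1 * x.1).1 i j = (x.1 * torus z⁻¹ z).1 i j := fun i j => by rw [hκx]
    simp only [coe_mul_apply] at hent
    have hl := lowerLeft_eq_zero x.2
    simp only [blkA] at hA hD n01 n10 h2
    have e00 := hent (.inl 0) (.inl 0)
    have e01 := hent (.inl 0) (.inl 1)
    have e10 := hent (.inl 1) (.inl 0)
    have e11 := hent (.inl 1) (.inl 1)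
    have e02 := hent (.inl 0) (.inr 0)
    simp [torus, hl, hA, hD] at e00 e01 e10 e11 e02
    have d10 := (blocks_of_mem_parabolicP x.2 0 0).1
    have d00 := (blocks_of_mem_parabolicP x.2 1 0).1
    simp only [hA, hD, zero_mul, zero_add, add_zero, reduceIte, one_ne_zero] at d10 d00
    have k01 := e00.resolve_right n10
    have k10 := e11.resolve_right n01
    have k00 : κ.1.1 (.inl 0) (.inl 0) = z := mul_right_cancel₀ n01 (e01.trans (mul_comm _ _))
    have k11 : κ.1.1 (.inl 1) (.inl 1) = (z : F)⁻¹ :=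
      mul_right_cancel₀ n10 (e10.trans (mul_comm _ _))
    have k03 : κ.1.1 (.inl 0) (.inr 1) = 0 := by
      refine (mul_eq_zero.1 ?_).resolve_right (right_ne_zero_of_mul_eq_one d10)
      rw [k00, k01, (mul_eq_zero.1 d00).resolve_left n01] at e02
      linear_combination e02
    have hκ : κ ∈ hyperbolicSubgroup F := ⟨k01, k10, by simp [blkA, k00, k11]⟩
    have hτ : τ ∈ hyperbolicSubgroup F := by
      refine ⟨?_, ?_, ?_⟩ <;> simp [τ, torus, blkA]
    have hκτ : x⁻¹ * κ * x = τ := by simp [κ, mul_assoc]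
    have h3 := h ⟨κ, hκ⟩ (by rw [Subgroup.subtype_apply, hκτ]; exact hτ)
    have h4 : hyperbolicChar γ ψ k ⟨κ, hκ⟩ = hyperbolicChar γ ψ k ⟨τ, hτ⟩ := by
      rw [h3]
      congr 1
      exact Subtype.ext hκτ
    change MulChar.ofUnitHom γ (κ.1.1 (.inl 0) (.inl 0)) ^ k *
      ψ (κ.1.1 (.inl 0) (.inr 1) * κ.1.1 (.inl 1) (.inl 1)) =
      MulChar.ofUnitHom γ ((torus z⁻¹ z).1 (.inl 0) (.inl 0)) ^ k *
      ψ ((torus z⁻¹ z).1 (.inl 0) (.inr 1) * (torus z⁻¹ z).1 (.inl 1) (.inl 1)) at h4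
    have t0 : (torus z⁻¹ z).1 (.inl 0) (.inl 0) = ((z⁻¹ : Fˣ) : F) := rfl
    have t1 : (torus z⁻¹ z).1 (.inl 0) (.inr 1) = 0 := rfl
    rw [t0, t1, k00, k03, zero_mul, zero_mul, AddChar.map_zero_eq_one, mul_one, mul_one,
      MulChar.ofUnitHom_coe, MulChar.ofUnitHom_coe] at h4
    have h5 : γ z ^ k = γ z⁻¹ ^ k := Units.ext (by push_cast; exact h4)
    rw [← map_pow, ← map_pow] at h5
    have h6 := hγ h5
    rw [inv_pow, eq_inv_iff_mul_eq_one, ← pow_add, ← two_mul] at h6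
    exact hz h6
  · have h10 := (mul_eq_zero.1 h0).resolve_left hA
    rw [h10, mul_zero, add_zero, sub_eq_zero] at h2
    exact ⟨(mul_eq_zero.1 h1).resolve_right (right_ne_zero_of_mul_eq_one h2), h10, h2⟩

theorem isIrrChar_chi5 [Fintype F] {γ : Fˣ →* ℂˣ} (hγ : Function.Injective γ) {ψ : AddChar F ℂ}
    (hψ : ψ ≠ 1) {k : ℕ} {z : Fˣ} (hz : z ^ (2 * k) ≠ 1) : IsIrrChar (chi5 γ ψ k) :=
  isIrrChar_indChar_of_agreeAt (hyperbolicSubgroup F) (hyperbolicChar γ ψ k)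
    fun _ hx => mem_hyperbolic_of_agreeAt hγ hψ hz hx

end Parabolic

/-! ### The multiplicity two -/

section Multiplicity

variable {F : Type*} [Field F]

theorem hyperbolicElem_mul_apply (t : Fˣ) (a b c : F) (x : Sp4 F) (j : Fin 2 ⊕ Fin 2) :
    (hyperbolicHom (hyperbolicElem t a b c) * x).1 (.inl 0) j = t * x.1 (.inl 0) j +
      a * t⁻¹ * x.1 (.inr 0) j + b * t * x.1 (.inr 1) j ∧
    (hyperbolicHom (hyperbolicElem t a b c) * x).1 (.inl 1) j = (t : F)⁻¹ * x.1 (.inl 1) j +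
      b * t⁻¹ * x.1 (.inr 0) j + c * t * x.1 (.inr 1) j ∧
    (hyperbolicHom (hyperbolicElem t a b c) * x).1 (.inr 0) j = (t : F)⁻¹ * x.1 (.inr 0) j ∧
    (hyperbolicHom (hyperbolicElem t a b c) * x).1 (.inr 1) j = t * x.1 (.inr 1) j := by
  change (upper a b c * torus t t⁻¹ * x).1 _ j = _ ∧ (upper a b c * torus t t⁻¹ * x).1 _ j = _ ∧
    (upper a b c * torus t t⁻¹ * x).1 _ j = _ ∧ (upper a b c * torus t t⁻¹ * x).1 _ j = _
  simp only [coe_mul_apply]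
  simp [upper, torus]

variable {γ : Fˣ →* ℂˣ} {ψ : AddChar F ℂ} {k : ℕ}

/-- A necessary condition for agreement at `x`, whose first two columns are `(u, w)` and `(u', w')`,
from an element of the subgroup inducing `χ₅(k)` that stabilizes the flag of `x`, with eigenvalues
`α`, `β`. -/
theorem AgreeAt.eq_of_hyperbolicElem {x : Sp4 F}
    (h : AgreeAt hyperbolicHom (borel F) (hyperbolicChar γ ψ k) (borelChar γ 1 2) x)
    {u₁ u₂ w₁ w₂ u₁' u₂' w₁' w₂' : F}
    (hx0 : ∀ i, x.1 i (.inl 0) = Sum.elim ![u₁, u₂] ![w₁, w₂] i)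
    (hx1 : ∀ i, x.1 i (.inl 1) = Sum.elim ![u₁', u₂'] ![w₁', w₂'] i)
    (t α β : Fˣ) (a b c d : F)
    (e1 : t * u₁ + a * t⁻¹ * w₁ + b * t * w₂ = α * u₁)
    (e2 : (t : F)⁻¹ * u₂ + b * t⁻¹ * w₁ + c * t * w₂ = α * u₂)
    (e3 : (t : F)⁻¹ * w₁ = α * w₁) (e4 : t * w₂ = α * w₂)
    (f1 : t * u₁' + a * t⁻¹ * w₁' + b * t * w₂' = β * u₁' + d * u₁)
    (f2 : (t : F)⁻¹ * u₂' + b * t⁻¹ * w₁' + c * t * w₂' = β * u₂' + d * u₂)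
    (f3 : (t : F)⁻¹ * w₁' = β * w₁' + d * w₁) (f4 : t * w₂' = β * w₂' + d * w₂) :
    (γ t : ℂ) ^ k * ψ b = γ α * (γ β : ℂ) ^ 2 := by
  have h1 := h.eq_of_columns (hyperbolicElem t a b c) α β d
    (fun i => by
      obtain ⟨r1, r2, r3, r4⟩ := hyperbolicElem_mul_apply t a b c x (.inl 0)
      rcases i with i | i <;> fin_cases i
      · exact r1.trans (by simpa [hx0] using e1)
      · exact r2.trans (by simpa [hx0] using e2)
      · exact r3.trans (by rw [hx0, hx0]; exact e3)
      · exact r4.trans (by rw [hx0, hx0]; exact e4))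
    (fun i => by
      obtain ⟨r1, r2, r3, r4⟩ := hyperbolicElem_mul_apply t a b c x (.inl 1)
      rcases i with i | i <;> fin_cases i
      · exact r1.trans (by simpa [hx0, hx1] using f1)
      · exact r2.trans (by simpa [hx0, hx1] using f2)
      · exact r3.trans (by simpa [hx0, hx1] using f3)
      · exact r4.trans (by simpa [hx0, hx1] using f4))
  rwa [hyperbolicChar_hyperbolicElem, pow_one] at h1

/-- An element carrying the standard flag to `⟨f₁ + f₂⟩ < ⟨f₁, f₂⟩`. -/
def genericFlag : Sp4 F :=
  ⟨Matrix.fromBlocks 0 !![-1, 1; 0, -1] !![1, 0; 1, 1] 0, by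
    rw [SymplecticGroup.fromBlocks_mem_iff]
    refine ⟨by simp, by simp, ?_⟩
    ext i j
    fin_cases i <;> fin_cases j <;> simp [Matrix.mul_apply, Fin.sum_univ_two]⟩

/-- Recognizing a double coset from the columns of its elements. -/
theorem exists_eq_mul_of_columns {x s : Sp4 F} (κ : hyperbolicSubgroup F) {α β d : F}
    (h0 : ∀ i, x.1 i (.inl 0) = α * (hyperbolicHom κ * s).1 i (.inl 0))
    (h1 : ∀ i, x.1 i (.inl 1) = β * (hyperbolicHom κ * s).1 i (.inl 1) +
      d * (hyperbolicHom κ * s).1 i (.inl 0)) :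
    ∃ κ, ∃ b : borel F, x = hyperbolicHom κ * s * (b : Sp4 F) :=
  ⟨κ, ⟨_, (inv_mul_mem_borel h0 h1).1⟩, by simp [mul_assoc]⟩

theorem not_forall_addChar_eq_one (hψ : ψ ≠ 1) (h : ∀ a, ψ a = 1) : False :=
  hψ (by ext a; exact h a)

/-- The characters inducing `χ₅(-3)` and `χ₁(1, 2)` agree on at most two double cosets: those of the
flags `⟨f₁⟩ < ⟨f₁, e₂⟩` and `⟨f₁ + f₂⟩ < ⟨f₁, f₂⟩`.

The columns `(u, w)` and `(u', w')` of `x` span its flag, and the case distinction is on the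
projection of this flag to `V / ⟨e₁, e₂⟩`. On every other double coset, an element of the
unipotent radical or of a conjugate of the torus separates the two characters. -/
theorem exists_eq_mul_of_agreeAt [Finite F] [CharP F 2] (hγ : Function.Injective γ) (hψ : ψ ≠ 1)
    (hk : ∀ u : Fˣ, u ^ (k + 3) = 1) {z : Fˣ} (hz : ∀ j, 1 ≤ j → j ≤ 6 → z ^ j ≠ 1) {x : Sp4 F}
    (h : AgreeAt hyperbolicHom (borel F) (hyperbolicChar γ ψ k) (borelChar γ 1 2) x) :
    (∃ κ, ∃ b : borel F, x = hyperbolicHom κ * weylFlip * (b : Sp4 F)) ∨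
      ∃ κ, ∃ b : borel F, x = hyperbolicHom κ * genericFlag * (b : Sp4 F) := by
  obtain ⟨u₁, hu₁⟩ : ∃ u, u = x.1 (.inl 0) (.inl 0) := ⟨_, rfl⟩
  obtain ⟨u₂, hu₂⟩ : ∃ u, u = x.1 (.inl 1) (.inl 0) := ⟨_, rfl⟩
  obtain ⟨w₁, hw₁⟩ : ∃ u, u = x.1 (.inr 0) (.inl 0) := ⟨_, rfl⟩
  obtain ⟨w₂, hw₂⟩ : ∃ u, u = x.1 (.inr 1) (.inl 0) := ⟨_, rfl⟩
  obtain ⟨u₁', hu₁'⟩ : ∃ u, u = x.1 (.inl 0) (.inl 1) := ⟨_, rfl⟩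
  obtain ⟨u₂', hu₂'⟩ : ∃ u, u = x.1 (.inl 1) (.inl 1) := ⟨_, rfl⟩
  obtain ⟨w₁', hw₁'⟩ : ∃ u, u = x.1 (.inr 0) (.inl 1) := ⟨_, rfl⟩
  obtain ⟨w₂', hw₂'⟩ : ∃ u, u = x.1 (.inr 1) (.inl 1) := ⟨_, rfl⟩
  have hx0 : ∀ i, x.1 i (.inl 0) = Sum.elim ![u₁, u₂] ![w₁, w₂] i := by
    rintro (i | i) <;> fin_cases i <;> simp [*]
  have hx1 : ∀ i, x.1 i (.inl 1) = Sum.elim ![u₁', u₂'] ![w₁', w₂'] i := by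
    rintro (i | i) <;> fin_cases i <;> simp [*]
  have hω := cols_orthogonal x
  rw [← hu₁, ← hu₂, ← hw₁, ← hw₂, ← hu₁', ← hu₂', ← hw₁', ← hw₂'] at hω
  have hne := col_inl_zero_ne_zero x
  have hu0 : w₁ = 0 → w₂ = 0 → u₁ = 0 → u₂ ≠ 0 := fun a1 a2 a3 a4 => hne (by
    funext i
    rw [hx0, a1, a2, a3, a4]
    rcases i with i | i <;> fin_cases i <;> rfl)
  have htwo : (2 : F) = 0 := CharTwo.two_eq_zero
  clear hu₁ hu₂ hw₁ hw₂ hu₁' hu₂' hw₁' hw₂' hne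
  have hz0 : (z : F) ≠ 0 := z.ne_zero
  -- In every excluded case with an additive witness, `ψ` would be trivial.
  have hadd : (∀ b : F, ∃ a c d : F, a * w₁ + b * w₂ = 0 ∧ b * w₁ + c * w₂ = 0 ∧
      a * w₁' + b * w₂' = d * u₁ ∧ b * w₁' + c * w₂' = d * u₂ ∧ d * w₁ = 0 ∧ d * w₂ = 0) →
      False := fun H => not_forall_addChar_eq_one hψ fun b => by
    obtain ⟨a, c, d, q1, q2, q3, q4, q5, q6⟩ := H b
    have := h.eq_of_hyperbolicElem hx0 hx1 1 1 1 a b c d (by simp [add_assoc, q1])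
      (by simp [add_assoc, q2]) (by simp) (by simp) (by simp [add_assoc, q3])
      (by simp [add_assoc, q4]) (by simp [q5]) (by simp [q6])
    simpa using this
  -- In every excluded case with a torus witness, `z` would have small order.
  have htor : ∀ (α β : Fˣ) (a c d : F) , (z * u₁ + a * z⁻¹ * w₁ = α * u₁) →
      ((z : F)⁻¹ * u₂ + c * z * w₂ = α * u₂) → ((z : F)⁻¹ * w₁ = α * w₁) → (z * w₂ = α * w₂) →
      (z * u₁' + a * z⁻¹ * w₁' = β * u₁' + d * u₁) →
      ((z : F)⁻¹ * u₂' + c * z * w₂' = β * u₂' + d * u₂) →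
      ((z : F)⁻¹ * w₁' = β * w₁' + d * w₁) → (z * w₂' = β * w₂' + d * w₂) →
      z ^ k = α * β ^ 2 := fun α β a c d q1 q2 q3 q4 q5 q6 q7 q8 => by
    have := h.eq_of_hyperbolicElem hx0 hx1 z α β a 0 c d (by simpa using q1) (by simpa using q2)
      q3 q4 (by simpa using q5) (by simpa using q6) q7 q8
    refine hγ (Units.ext ?_)
    rw [AddChar.map_zero_eq_one, mul_one] at this
    simpa using this
  have hkz := hk z
  by_cases h1 : w₁ = 0
  · exfalso
    by_cases h2 : w₂ = 0
    · -- `w = 0`: the radical element with `X = (0 b; b 0)` fixes the line, and the plane as well.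
      subst h1 h2
      refine hadd fun b => ?_
      by_cases h3 : u₁ = 0
      · have h4 := hu0 rfl rfl h3
        refine ⟨0, 0, b * w₁' / u₂, ?_⟩
        subst h3
        have h5 : w₂' = 0 := by
          refine (mul_eq_zero.1 (?_ : u₂ * w₂' = 0)).resolve_left h4
          linear_combination hω
        subst h5
        simp [h4]
      · refine ⟨0, 0, b * w₂' / u₁, by simp, by simp, ?_, ?_, by simp, by simp⟩
        · field_simp
          ring
        · field_simp
          linear_combination b * hω - b * u₂ * w₂' * htwo
    · subst h1
      by_cases h3 : w₁' = 0
      · -- The plane meets `⟨e₁, e₂⟩` in a line; comparison on a torus gives `z ^ k = z ^ 3`.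
        subst h3
        have h4 := htor z z 0 ((z - (z : F)⁻¹) * u₂ / (z * w₂)) 0 (by simp)
          (by field_simp; ring) (by simp) rfl (by simp)
          (by field_simp; linear_combination ((z : F) ^ 2 - 1) * hω) (by simp) (by simp)
        refine hz 6 (by norm_num) (by norm_num) ?_
        rw [pow_add, h4, ← pow_succ', ← pow_add] at hkz
        exact hkz
      · -- The plane is a complement of `⟨e₁, e₂⟩`; comparison on a torus gives `z ^ k = z⁻¹`.
        have h4 := htor z z⁻¹
          ((((z : F)⁻¹ - z) * u₁' + (z - (z : F)⁻¹) * w₂' / w₂ * u₁) * z / w₁')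
          ((z - (z : F)⁻¹) * u₂ / (z * w₂)) ((z - (z : F)⁻¹) * w₂' / w₂) (by simp)
          (by field_simp; ring) (by simp) rfl (by push_cast; field_simp; ring)
          (by push_cast; field_simp) (by simp) (by push_cast; field_simp; ring)
        refine hz 2 (by norm_num) (by norm_num) ?_
        rw [pow_add, h4] at hkz
        rw [← hkz]
        group
  · by_cases h2 : w₂ = 0
    · subst h2
      by_cases h3 : w₂' = 0
      · -- The double coset of `⟨f₁⟩ < ⟨f₁, e₂⟩`.
        left
        subst h3
        refine exists_eq_mul_of_columns (hyperbolicElem 1 (u₁ / w₁) (u₂ / w₁) 0)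
          (α := w₁) (β := u₂' - w₁' * u₂ / w₁) (d := w₁') ?_ ?_
        · obtain ⟨r1, r2, r3, r4⟩ := hyperbolicElem_mul_apply 1 (u₁ / w₁) (u₂ / w₁) 0 weylFlip
            (.inl 0)
          rintro (i | i) <;> fin_cases i <;>
            simp only [hx0, Fin.zero_eta, Fin.mk_one, r1, r2, r3, r4] <;> simp [weylFlip] <;>
            field_simp
        · obtain ⟨r1, r2, r3, r4⟩ := hyperbolicElem_mul_apply 1 (u₁ / w₁) (u₂ / w₁) 0 weylFlip
            (.inl 1)
          obtain ⟨s1, s2, s3, s4⟩ := hyperbolicElem_mul_apply 1 (u₁ / w₁) (u₂ / w₁) 0 weylFlip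
            (.inl 0)
          rintro (i | i) <;> fin_cases i <;>
            simp only [hx1, Fin.zero_eta, Fin.mk_one, r1, r2, r3, r4, s1, s2, s3, s4] <;>
            simp [weylFlip] <;> field_simp
          · linear_combination -hω
          · ring
      · -- The plane is a complement of `⟨e₁, e₂⟩`; comparison on a torus gives `z ^ k = z`.
        exfalso
        have h4 := htor z⁻¹ z ((1 - z ^ 2) * u₁ / w₁)
          (((z - (z : F)⁻¹) * u₂' + ((z : F)⁻¹ - z) * w₁' / w₁ * u₂) / (z * w₂'))
          (((z : F)⁻¹ - z) * w₁' / w₁) (by push_cast; field_simp; ring) (by simp) (by simp)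
          (by simp) (by push_cast; field_simp)
          (by field_simp; ring) (by field_simp; ring) (by simp)
        refine hz 4 (by norm_num) (by norm_num) ?_
        rw [pow_add, h4] at hkz
        rw [← hkz]
        group
    · by_cases h3 : w₁ * w₂' = w₂ * w₁'
      · -- `w` and `w'` are proportional; the radical element with `X w = 0` and `X₁₂ = b` fixes the
        -- flag.
        exfalso
        refine hadd fun b => ⟨b * w₂ / w₁, b * w₁ / w₂, 0, ?_, ?_, ?_, ?_, by simp, by simp⟩
        · field_simp
          linear_combination b * w₂ * htwo
        · field_simp
          linear_combination b * w₁ * htwo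
        · field_simp
          linear_combination b * h3 + b * w₂ * w₁' * htwo
        · field_simp
          linear_combination b * h3 + b * w₂ * w₁' * htwo
      · -- The double coset of `⟨f₁ + f₂⟩ < ⟨f₁, f₂⟩`: the torus takes `f₁ + f₂` to a multiple of
        -- `w₁ f₁ + w₂ f₂` since `w₂ / w₁` is a square.
        right
        obtain ⟨t, ht⟩ := FiniteField.isSquare_of_char_two (F := F)
          (CharP.ringChar_of_prime_eq_zero Nat.prime_two (by simpa using htwo)) (w₂ / w₁)
        have ht0 : t ≠ 0 := by
          rintro rfl
          simp [h1, h2] at ht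
        have hδ := sub_ne_zero.2 h3
        have hw : w₂ = w₁ * (t * t) := by
          rw [← ht]
          field_simp
        subst hw
        have hδ1 : w₂' - t ^ 2 * w₁' ≠ 0 := fun h0 => hδ (by linear_combination w₁ * h0)
        have hδ2 : w₂' - w₁' * t ^ 2 ≠ 0 := by rwa [mul_comm w₁']
        -- `X = U W⁻¹`, where `(U; W)` is the left half of `x`.
        refine exists_eq_mul_of_columns (hyperbolicElem (Units.mk0 t ht0)
          ((u₁ * w₂' - u₁' * (w₁ * (t * t))) / (w₁ * w₂' - w₁ * (t * t) * w₁'))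
          ((u₁' * w₁ - u₁ * w₁') / (w₁ * w₂' - w₁ * (t * t) * w₁'))
          ((u₂' * w₁ - u₂ * w₁') / (w₁ * w₂' - w₁ * (t * t) * w₁')))
          (α := w₁ * t) (β := (w₂' - w₁' * t ^ 2) / t) (d := w₁' * t) (fun i => ?_) (fun i => ?_)
        all_goals
          obtain ⟨r1, r2, r3, r4⟩ := hyperbolicElem_mul_apply (Units.mk0 t ht0)
            ((u₁ * w₂' - u₁' * (w₁ * (t * t))) / (w₁ * w₂' - w₁ * (t * t) * w₁'))
            ((u₁' * w₁ - u₁ * w₁') / (w₁ * w₂' - w₁ * (t * t) * w₁'))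
            ((u₂' * w₁ - u₂ * w₁') / (w₁ * w₂' - w₁ * (t * t) * w₁')) genericFlag (.inl 0)
          obtain ⟨s1, s2, s3, s4⟩ := hyperbolicElem_mul_apply (Units.mk0 t ht0)
            ((u₁ * w₂' - u₁' * (w₁ * (t * t))) / (w₁ * w₂' - w₁ * (t * t) * w₁'))
            ((u₁' * w₁ - u₁ * w₁') / (w₁ * w₂' - w₁ * (t * t) * w₁'))
            ((u₂' * w₁ - u₂ * w₁') / (w₁ * w₂' - w₁ * (t * t) * w₁')) genericFlag (.inl 1)
          rcases i with i | i <;> fin_cases i <;>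
            simp only [hx0, hx1, Fin.zero_eta, Fin.mk_one, r1, r2, r3, r4, s1, s2, s3, s4] <;>
            simp [genericFlag] <;> field_simp
        · ring
        · linear_combination hω
        · ring
        · linear_combination w₁' * hω
        · ring

/-- The eigenvalues of an element stabilizing the flag of `x`, read off from the first two
columns. -/
theorem columns_of_conj_mem_borel {x g : Sp4 F} (hb : x⁻¹ * g * x ∈ borel F)
    (i : Fin 2 ⊕ Fin 2) :
    (g * x).1 i (.inl 0) = x.1 i (.inl 0) * blkA (x⁻¹ * g * x) 0 0 ∧
    (g * x).1 i (.inl 1) =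
      x.1 i (.inl 0) * blkA (x⁻¹ * g * x) 0 1 + x.1 i (.inl 1) * blkA (x⁻¹ * g * x) 1 1 := by
  obtain ⟨h10, hl⟩ := mem_borel_iff.1 hb
  have he : g * x = x * (x⁻¹ * g * x) := by group
  constructor <;>
  · rw [he, coe_mul_apply x]
    simp only [blkA, h10, hl]
    ring

theorem hyperbolicChar_apply (κ : hyperbolicSubgroup F) : hyperbolicChar γ ψ k κ =
    MulChar.ofUnitHom γ (κ.1.1.1 (.inl 0) (.inl 0)) ^ k *
      ψ (κ.1.1.1 (.inl 0) (.inr 1) * κ.1.1.1 (.inl 1) (.inl 1)) := rfl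

theorem borelChar_apply {m n : ℕ} (b : borel F) : borelChar γ m n b =
    MulChar.ofUnitHom γ (blkA b.1 0 0) ^ m * MulChar.ofUnitHom γ (blkA b.1 1 1) ^ n := rfl

theorem agreeAt_weylFlip (hk : ∀ u : Fˣ, u ^ (k + 3) = 1) :
    AgreeAt hyperbolicHom (borel F) (hyperbolicChar γ ψ k) (borelChar γ 1 2) weylFlip := by
  intro κ hb
  have hc := columns_of_conj_mem_borel hb
  obtain ⟨h01, h10, hd01, hd10, hd00, hd11, hdet, hsym⟩ := entries_of_mem_hyperbolic κ
  have hκ : ∀ i j, (hyperbolicHom κ).1 i j = κ.1.1.1 i j := fun _ _ => rfl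
  rw [hyperbolicChar_apply, borelChar_apply]
  simp only [coe_mul_apply (hyperbolicHom κ), hκ] at hc
  have c1 := (hc (.inl 1)).1
  have c2 := (hc (.inr 0)).1
  have c3 := (hc (.inl 1)).2
  set α := blkA (weylFlip⁻¹ * hyperbolicHom κ * weylFlip) 0 0
  set β := blkA (weylFlip⁻¹ * hyperbolicHom κ * weylFlip) 1 1
  simp [weylFlip] at c1 c2 c3
  rw [hsym, c1, zero_mul, AddChar.map_zero_eq_one, mul_one]
  rw [hd00] at c2
  rw [← c2, ← c3, pow_one, ← pow_succ']
  obtain ⟨t, ht⟩ : ∃ t : Fˣ, (t : F) = κ.1.1.1 (.inl 0) (.inl 0) :=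
    ⟨Units.mk0 _ (left_ne_zero_of_mul_eq_one hdet), rfl⟩
  have ht' : κ.1.1.1 (.inl 1) (.inl 1) = ((t⁻¹ : Fˣ) : F) := by
    rw [Units.val_inv_eq_inv_val, ht]
    exact eq_inv_of_mul_eq_one_right hdet
  rw [ht', ← ht, MulChar.ofUnitHom_coe, MulChar.ofUnitHom_coe, ← Units.val_pow_eq_pow_val,
    ← Units.val_pow_eq_pow_val, ← map_pow, ← map_pow]
  congr 2
  rw [inv_pow, eq_inv_iff_mul_eq_one, ← pow_add]
  exact hk t

theorem agreeAt_genericFlag [CharP F 2] :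
    AgreeAt hyperbolicHom (borel F) (hyperbolicChar γ ψ k) (borelChar γ 1 2) genericFlag := by
  intro κ hb
  have hc := columns_of_conj_mem_borel hb
  obtain ⟨h01, h10, hd01, hd10, hd00, hd11, hdet, hsym⟩ := entries_of_mem_hyperbolic κ
  have hκ : ∀ i j, (hyperbolicHom κ).1 i j = κ.1.1.1 i j := fun _ _ => rfl
  rw [hyperbolicChar_apply, borelChar_apply]
  simp only [coe_mul_apply (hyperbolicHom κ), hκ] at hc
  have c1 := (hc (.inr 0)).1
  have c2 := (hc (.inr 1)).1
  have c3 := (hc (.inr 0)).2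
  have c4 := (hc (.inr 1)).2
  have c5 := (hc (.inl 0)).2
  set α := blkA (genericFlag⁻¹ * hyperbolicHom κ * genericFlag) 0 0
  set β := blkA (genericFlag⁻¹ * hyperbolicHom κ * genericFlag) 1 1
  set δ := blkA (genericFlag⁻¹ * hyperbolicHom κ * genericFlag) 0 1
  simp [genericFlag, hd01, hd10, hd00, hd11, h01] at c1 c2 c3 c4 c5
  -- `t = t⁻¹`, hence `t = 1` in characteristic two.
  have hα : α = 1 := by
    rw [c1, c2] at hdet
    have h2 : (α - 1) * (α - 1) = 0 := by
      linear_combination hdet + (1 - α) * (CharTwo.two_eq_zero (R := F))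
    exact sub_eq_zero.1 (mul_self_eq_zero.1 h2)
  rw [← c3, zero_add, c2, hα] at c4
  rw [c5, zero_mul, AddChar.map_zero_eq_one, c2, hα, ← c4]
  simp

theorem genericFlag_ne (κ : hyperbolicSubgroup F) {b : Sp4 F} (hb : b ∈ borel F) :
    genericFlag ≠ hyperbolicHom κ * weylFlip * b := fun h => by
  obtain ⟨hb0, hbl⟩ := mem_borel_iff.1 hb
  have h1 : (genericFlag : Sp4 F).1 (.inr 1) (.inl 0) =
      (hyperbolicHom κ * weylFlip * b).1 (.inr 1) (.inl 0) := by rw [← h]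
  have hκ : (hyperbolicHom κ).1 (.inr 1) (.inr 0) = 0 := (entries_of_mem_hyperbolic κ).2.2.2.1
  have hκ' : (hyperbolicHom κ).1 (.inr 1) (.inl 1) = 0 := lowerLeft_eq_zero κ.1.2 1 1
  simp only [coe_mul_apply, hb0, hbl, hκ, hκ'] at h1
  simp [genericFlag, weylFlip] at h1

theorem charInner_chi5_chi1 [Fintype F] [CharP F 2] (hγ : Function.Injective γ) (hψ : ψ ≠ 1)
    (hk : ∀ u : Fˣ, u ^ (k + 3) = 1) {z : Fˣ} (hz : ∀ j, 1 ≤ j → j ≤ 6 → z ^ j ≠ 1) :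
    charInner (chi5 γ ψ k) (resChar (parabolicP F) (chi1 γ 1 2)) = 2 := by
  classical
  have hcl : ∀ y g, chi1 γ 1 2 (y * g * y⁻¹) = chi1 γ 1 2 g := indChar_conj (borel F) _
  have h1 : charInner (chi5 γ ψ k) (resChar (parabolicP F) (chi1 γ 1 2)) =
      charInner (hyperbolicChar γ ψ k) fun κ => chi1 γ 1 2 (hyperbolicHom κ) :=
    charInner_indChar (hyperbolicSubgroup F) (hyperbolicChar γ ψ k)
      (resChar (parabolicP F) (chi1 γ 1 2)) fun y g => hcl y.1 g.1
  have hne := genericFlag_ne (F := F)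
  have h2 := charInner_comp_indChar (ι := hyperbolicHom) (B := borel F)
    (lam := hyperbolicChar γ ψ k) (mu := borelChar γ 1 2) {weylFlip, genericFlag}
    (by
      simp only [Finset.mem_insert, Finset.mem_singleton]
      rintro s (rfl | rfl)
      · exact agreeAt_weylFlip hk
      · exact agreeAt_genericFlag)
    (fun x hx => by
      rcases exists_eq_mul_of_agreeAt hγ hψ hk hz hx with h | h
      · exact ⟨weylFlip, by simp, h⟩
      · exact ⟨genericFlag, by simp, h⟩)
    (by
      simp only [Finset.mem_insert, Finset.mem_singleton]
      rintro s (rfl | rfl) s' (rfl | rfl) κ b h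
      · rfl
      · exact absurd h (hne κ b.2)
      · refine absurd ?_ (hne κ⁻¹ (inv_mem b.2))
        rw [h]
        simp [mul_assoc]
      · rfl)
  rw [Finset.card_pair (fun h => hne 1 (one_mem _) (by simp [h]))] at h2
  rw [h1]
  exact h2

end Multiplicity

/-! ### The exceptional graph automorphism in characteristic two -/

section GraphAutomorphism

variable {F : Type*} [Field F]

/-- The first vector of the pairs `e₁ ∧ e₂`, `e₁ ∧ f₂`, `f₁ ∧ f₂`, `f₁ ∧ e₂`. -/
def wedgeFst : Fin 2 ⊕ Fin 2 → Fin 2 ⊕ Fin 2 := Sum.elim ![.inl 0, .inl 0] ![.inr 0, .inr 0]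

/-- The second vector of the pairs `e₁ ∧ e₂`, `e₁ ∧ f₂`, `f₁ ∧ f₂`, `f₁ ∧ e₂`. -/
def wedgeSnd : Fin 2 ⊕ Fin 2 → Fin 2 ⊕ Fin 2 := Sum.elim ![.inl 1, .inr 1] ![.inr 1, .inl 1]

/-- The matrix of `2 × 2` minors of `M` on the four pairs `e₁ ∧ e₂`, `e₁ ∧ f₂`, `f₁ ∧ f₂`,
`f₁ ∧ e₂`. In characteristic two these span `ω^⊥ / ω` in the exterior square, where
`ω = e₁ ∧ f₁ + e₂ ∧ f₂` is fixed by the symplectic group. -/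
def wedgeMatrix (M : Matrix (Fin 2 ⊕ Fin 2) (Fin 2 ⊕ Fin 2) F) :
    Matrix (Fin 2 ⊕ Fin 2) (Fin 2 ⊕ Fin 2) F := fun i j =>
  M (wedgeFst i) (wedgeFst j) * M (wedgeSnd i) (wedgeSnd j) -
    M (wedgeFst i) (wedgeSnd j) * M (wedgeSnd i) (wedgeFst j)

theorem wedgeMatrix_transpose (M : Matrix (Fin 2 ⊕ Fin 2) (Fin 2 ⊕ Fin 2) F) :
    wedgeMatrix Mᵀ = (wedgeMatrix M)ᵀ := by
  ext i j
  simp only [wedgeMatrix, Matrix.transpose_apply]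
  ring

theorem rows_symplectic {M : Matrix (Fin 2 ⊕ Fin 2) (Fin 2 ⊕ Fin 2) F}
    (hM : M ∈ Matrix.symplecticGroup (Fin 2) F) (r s : Fin 2 ⊕ Fin 2) :
    M r (.inr 0) * M s (.inl 0) + M r (.inr 1) * M s (.inl 1) - M r (.inl 0) * M s (.inr 0) -
      M r (.inl 1) * M s (.inr 1) = Matrix.J (Fin 2) F r s := by
  rw [← congrFun₂ (SymplecticGroup.mem_iff.1 hM) r s, Matrix.mul_apply]
  simp only [Matrix.mul_apply, Fintype.sum_sum_type, Fin.sum_univ_two, Matrix.transpose_apply]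
  simp [Matrix.J]
  ring

theorem J_wedge (i : Fin 2 ⊕ Fin 2) : Matrix.J (Fin 2) F (wedgeFst i) (wedgeSnd i) = 0 := by
  rcases i with i | i <;> fin_cases i <;> simp [wedgeFst, wedgeSnd, Matrix.J]

/-- The Cauchy–Binet formula, in which the contributions of `e₁ ∧ f₁` and `e₂ ∧ f₂` cancel. -/
theorem wedgeMatrix_mul [CharP F 2] {M N : Matrix (Fin 2 ⊕ Fin 2) (Fin 2 ⊕ Fin 2) F}
    (hM : M ∈ Matrix.symplecticGroup (Fin 2) F) (hN : N ∈ Matrix.symplecticGroup (Fin 2) F) :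
    wedgeMatrix (M * N) = wedgeMatrix M * wedgeMatrix N := by
  ext i j
  have h1 := rows_symplectic hM (wedgeFst i) (wedgeSnd i)
  have h2 := rows_symplectic (SymplecticGroup.transpose_mem hN) (wedgeFst j) (wedgeSnd j)
  rw [J_wedge] at h1 h2
  simp only [Matrix.transpose_apply] at h2
  have h3 : (2 : F) = 0 := CharTwo.two_eq_zero
  rw [Matrix.mul_apply]
  simp only [wedgeMatrix, Matrix.mul_apply, Fintype.sum_sum_type, Fin.sum_univ_two]
  generalize wedgeFst i = a at *
  generalize wedgeSnd i = b at *
  generalize wedgeFst j = c at *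
  generalize wedgeSnd j = d at *
  simp only [wedgeFst, wedgeSnd, Sum.elim_inl, Sum.elim_inr, Matrix.cons_val_zero,
    Matrix.cons_val_one]
  linear_combination
    -(N (.inl 1) c * N (.inr 1) d - N (.inl 1) d * N (.inr 1) c) * h1 -
    (M a (.inl 0) * M b (.inr 0) - M a (.inr 0) * M b (.inl 0)) * h2 -
    (M a (.inl 0) * M b (.inr 0) - M a (.inr 0) * M b (.inl 0)) *
    (N (.inl 1) c * N (.inr 1) d - N (.inl 1) d * N (.inr 1) c) * h3

theorem wedgeMatrix_J [CharP F 2] : wedgeMatrix (Matrix.J (Fin 2) F) = Matrix.J (Fin 2) F := by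
  ext (i | i) (j | j) <;> fin_cases i <;> fin_cases j <;>
    simp [wedgeMatrix, wedgeFst, wedgeSnd, Matrix.J, CharTwo.neg_eq]

theorem wedgeMatrix_one : wedgeMatrix (1 : Matrix (Fin 2 ⊕ Fin 2) (Fin 2 ⊕ Fin 2) F) = 1 := by
  ext (i | i) (j | j) <;> fin_cases i <;> fin_cases j <;>
    simp [wedgeMatrix, wedgeFst, wedgeSnd, Matrix.one_apply]

theorem wedgeMatrix_mem [CharP F 2] (g : Sp4 F) :
    wedgeMatrix g.1 ∈ Matrix.symplecticGroup (Fin 2) F := by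
  rw [SymplecticGroup.mem_iff]
  have hJ := SymplecticGroup.J_mem (Fin 2) F
  conv_lhs => rw [← wedgeMatrix_J, ← wedgeMatrix_transpose]
  rw [← wedgeMatrix_mul g.2 hJ,
    ← wedgeMatrix_mul (mul_mem g.2 hJ) (SymplecticGroup.transpose_mem g.2),
    SymplecticGroup.mem_iff.1 g.2, wedgeMatrix_J]

/-- The graph endomorphism of `Sp₄(F)` in characteristic two. -/
def graphHom [CharP F 2] : Sp4 F →* Sp4 F where
  toFun g := ⟨wedgeMatrix g.1, wedgeMatrix_mem g⟩
  map_one' := Subtype.ext wedgeMatrix_one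
  map_mul' g h := Subtype.ext (wedgeMatrix_mul g.2 h.2)

/-- If `r ∧ s` has a nonzero coordinate at `a ∧ b` but none at `a ∧ k` and `b ∧ k`, then `r` and `s`
vanish at `k`. -/
theorem eq_zero_of_minors {r s : Vec F} {a b k : Fin 2 ⊕ Fin 2} (h : r a * s b - r b * s a = 1)
    (ha : r a * s k - r k * s a = 0) (hb : r b * s k - r k * s b = 0) : r k = 0 ∧ s k = 0 :=
  ⟨by linear_combination (-r k) * h + r b * ha - r a * hb,
    by linear_combination (-s k) * h + s b * ha - s a * hb⟩

theorem graphHom_injective [CharP F 2] : Function.Injective (graphHom (F := F)) := by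
  rw [injective_iff_map_eq_one]
  intro g hg
  have hM : wedgeMatrix g.1 = 1 := congrArg Subtype.val hg
  have hij : ∀ i j, wedgeMatrix g.1 i j = if i = j then 1 else 0 := fun i j => by
    rw [hM, Matrix.one_apply]
  have h2 : (2 : F) = 0 := CharTwo.two_eq_zero
  -- By the Plücker relation the coordinates at `e₁ ∧ f₁` and `e₂ ∧ f₂` also vanish.
  have hpl : ∀ i, g.1 (wedgeFst i) (.inl 0) * g.1 (wedgeSnd i) (.inr 0) -
      g.1 (wedgeFst i) (.inr 0) * g.1 (wedgeSnd i) (.inl 0) = 0 ∧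
      g.1 (wedgeFst i) (.inl 1) * g.1 (wedgeSnd i) (.inr 1) -
      g.1 (wedgeFst i) (.inr 1) * g.1 (wedgeSnd i) (.inl 1) = 0 := fun i => by
    have hr := rows_symplectic g.2 (wedgeFst i) (wedgeSnd i)
    rw [J_wedge] at hr
    have h0 : wedgeMatrix g.1 i (.inl 0) * wedgeMatrix g.1 i (.inr 0) = 0 := by
      rw [hij, hij]
      rcases i with i | i <;> simp
    have h1 : wedgeMatrix g.1 i (.inl 1) * wedgeMatrix g.1 i (.inr 1) = 0 := by
      rw [hij, hij]
      rcases i with i | i <;> simp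
    simp only [wedgeMatrix] at h0 h1
    generalize wedgeFst i = a at *
    generalize wedgeSnd i = b at *
    simp only [wedgeFst, wedgeSnd, Sum.elim_inl, Sum.elim_inr, Matrix.cons_val_zero,
      Matrix.cons_val_one] at h0 h1
    have hsq : (g.1 a (.inl 0) * g.1 b (.inr 0) - g.1 a (.inr 0) * g.1 b (.inl 0)) *
        (g.1 a (.inl 0) * g.1 b (.inr 0) - g.1 a (.inr 0) * g.1 b (.inl 0)) = 0 := by
      linear_combination -h0 + h1 - (g.1 a (.inl 0) * g.1 b (.inr 0) -
        g.1 a (.inr 0) * g.1 b (.inl 0)) * hr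
    have hA := mul_self_eq_zero.1 hsq
    exact ⟨hA, by linear_combination -hr - hA⟩
  have h := hij
  simp only [wedgeMatrix] at h
  have hs := rows_symplectic g.2 (.inl 0) (.inr 0)
  have p0 := hpl (.inl 0)
  have p1 := hpl (.inl 1)
  have p2 := hpl (.inr 0)
  have p3 := hpl (.inr 1)
  have h00 := h (.inl 0) (.inl 0)
  have h01 := h (.inl 0) (.inl 1)
  have h03 := h (.inl 0) (.inr 1)
  have h10 := h (.inl 1) (.inl 0)
  have h11 := h (.inl 1) (.inl 1)
  have h12 := h (.inl 1) (.inr 0)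
  have h21 := h (.inr 0) (.inl 1)
  have h22 := h (.inr 0) (.inr 0)
  have h23 := h (.inr 0) (.inr 1)
  have h30 := h (.inr 1) (.inl 0)
  have h32 := h (.inr 1) (.inr 0)
  have h33 := h (.inr 1) (.inr 1)
  simp [wedgeFst, wedgeSnd] at h00 h01 h03 h10 h11 h12 h21 h22 h23 h30 h32 h33
  simp [wedgeFst, wedgeSnd, Matrix.J] at p0 p1 p2 p3 hs
  -- The off-diagonal entries vanish, two at a time.
  obtain ⟨a1, a2⟩ := eq_zero_of_minors (k := .inr 0) h00 p0.1 (by linear_combination -h03)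
  obtain ⟨a3, a4⟩ := eq_zero_of_minors (k := .inr 1) h00 h01 p0.2
  obtain ⟨b1, b2⟩ := eq_zero_of_minors (k := .inr 0) h11 p1.1 (by linear_combination -h12)
  obtain ⟨b3, b4⟩ := eq_zero_of_minors (k := .inl 1) h11 h10 (by linear_combination -p1.2)
  obtain ⟨c1, c2⟩ := eq_zero_of_minors (k := .inl 0) h22 (by linear_combination -p2.1)
    (by linear_combination -h21)
  obtain ⟨c3, c4⟩ := eq_zero_of_minors (k := .inl 1) h22 h23 (by linear_combination -p2.2)
  obtain ⟨d1, d2⟩ := eq_zero_of_minors (k := .inl 0) h33 (by linear_combination -p3.1)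
    (by linear_combination -h30)
  obtain ⟨d3, d4⟩ := eq_zero_of_minors (k := .inr 1) h33 h32 p3.2
  simp only [a1, a2, a3, b2, b3, c1, c2, c3, d2, d3, mul_zero, sub_zero, zero_sub,
    add_zero] at h00 h11 h22 h33 hs
  -- The diagonal entries are `x, x⁻¹, x, x⁻¹` with `x ^ 2 = 1`, and `x = 1` in characteristic two.
  have hzx : g.1 (.inr 0) (.inr 0) = g.1 (.inl 0) (.inl 0) := by
    linear_combination g.1 (.inl 0) (.inl 0) * h33 - g.1 (.inr 0) (.inr 0) * h00
  rw [hzx] at hs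
  have hx : g.1 (.inl 0) (.inl 0) = 1 := by
    refine sub_eq_zero.1 (mul_self_eq_zero.1 ?_)
    linear_combination -hs + (1 - g.1 (.inl 0) (.inl 0)) * h2
  rw [hx, one_mul] at h00 h11
  rw [hx] at hzx
  ext i j
  rcases i with i | i <;> rcases j with j | j <;> fin_cases i <;> fin_cases j <;>
    simp [*]

theorem graphHom_mem_parabolicP [CharP F 2] {g : Sp4 F} (hg : g ∈ stab (stdLine F)) :
    graphHom g ∈ stab (stdPlane F) := by
  obtain ⟨h1, h2, h3⟩ := mem_stab_stdLine_iff.1 hg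
  refine mem_parabolicP_iff.2 fun i j => ?_
  change wedgeMatrix g.1 _ _ = 0
  fin_cases i <;> fin_cases j <;> simp [wedgeMatrix, wedgeFst, wedgeSnd, h1, h2, h3]

theorem graphHom_mem_stab_stdLine [CharP F 2] {g : Sp4 F} (hg : g ∈ stab (stdPlane F)) :
    graphHom g ∈ stab (stdLine F) := by
  have h := mem_parabolicP_iff.1 hg
  refine mem_stab_stdLine_iff.2 ⟨?_, ?_, ?_⟩ <;>
  · change wedgeMatrix g.1 _ _ = 0
    simp [wedgeMatrix, wedgeFst, wedgeSnd, h]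

/-- The graph automorphism of `Sp₄(F)`, for `F` finite of characteristic two. -/
def graphEquiv [Finite F] [CharP F 2] : Sp4 F ≃* Sp4 F :=
  MulEquiv.ofBijective graphHom (Finite.injective_iff_bijective.1 graphHom_injective)

/-- The graph automorphism exchanges the two classes of maximal parabolic subgroups. -/
theorem mem_stab_stdLine_iff_graphEquiv_mem [Finite F] [CharP F 2] (g : Sp4 F) :
    g ∈ stab (stdLine F) ↔ graphEquiv g ∈ stab (stdPlane F) := by
  refine ⟨graphHom_mem_parabolicP, fun hg => ?_⟩
  -- The square of the automorphism maps the stabilizer of the plane into, hence onto, itself.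
  let φ : stab (stdPlane F) → stab (stdPlane F) := fun h =>
    ⟨graphHom (graphHom h.1), graphHom_mem_parabolicP (graphHom_mem_stab_stdLine h.2)⟩
  have hφ : Function.Injective φ := fun h h' hh =>
    Subtype.ext (graphHom_injective (graphHom_injective (congrArg Subtype.val hh)))
  obtain ⟨h, hh⟩ := Finite.injective_iff_surjective.1 hφ ⟨graphEquiv g, hg⟩
  rw [← graphHom_injective (congrArg Subtype.val hh : graphHom (graphHom h.1) = graphHom g)]
  exact graphHom_mem_stab_stdLine h.2

end GraphAutomorphism

/-! ### Parabolic subgroups are not strong Gelfand subgroups -/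

section Parabolic

variable {F : Type*} [Field F] [Fintype F] {e : ℕ}

theorem charP_two_of_card (hq : Fintype.card F = 2 ^ e) : CharP F 2 :=
  charP_of_card_eq_prime_pow hq

theorem exists_injective_unitsHom : ∃ γ : Fˣ →* ℂˣ, Function.Injective γ := by
  let f : Fˣ ≃* rootsOfUnity (Nat.card Fˣ) ℂ :=
    mulEquivOfCyclicCardEq (Complex.card_rootsOfUnity _).symm
  exact ⟨(rootsOfUnity _ ℂ).subtype.comp f.toMonoidHom, Subtype.val_injective.comp f.injective⟩

theorem exists_addChar_ne_one : ∃ ψ : AddChar F ℂ, ψ ≠ 1 := by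
  obtain ⟨ψ, hψ⟩ := AddChar.exists_apply_ne_zero.2 (one_ne_zero (α := F))
  exact ⟨ψ, fun h => hψ (by rw [h, AddChar.one_apply])⟩

/-- The weight `q - 4` equals `-3` modulo the order `q - 1` of the units. -/
theorem units_pow_card_sub_four_add_three (he : 2 < e) (hq : Fintype.card F = 2 ^ e) (u : Fˣ) :
    u ^ (Fintype.card F - 4 + 3) = 1 := by
  have h8 : 2 ^ 3 ≤ 2 ^ e := Nat.pow_le_pow_right two_pos he
  have h : Fintype.card F - 4 + 3 = Fintype.card F - 1 := by omega
  rw [h, Units.ext_iff, Units.val_pow_eq_pow_val]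
  exact FiniteField.pow_card_sub_one_eq_one _ u.ne_zero

theorem isIrrChar_chi5_card_sub_four (he : 2 < e) (hq : Fintype.card F = 2 ^ e) {γ : Fˣ →* ℂˣ}
    (hγ : Function.Injective γ) {ψ : AddChar F ℂ} (hψ : ψ ≠ 1) :
    IsIrrChar (chi5 γ ψ (Fintype.card F - 4)) := by
  obtain ⟨z, hz⟩ := exists_unit_pow_ne_one he hq
  refine isIrrChar_chi5 hγ hψ (z := z) fun h => hz 6 (by norm_num) le_rfl ?_
  calc z ^ 6 = z ^ (2 * (Fintype.card F - 4)) * z ^ 6 := by rw [h, one_mul]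
    _ = (z ^ (Fintype.card F - 4 + 3)) ^ 2 := by rw [← pow_add, ← pow_mul]; congr 1; ring
    _ = 1 := by rw [units_pow_card_sub_four_add_three he hq, one_pow]

theorem charInner_chi5_card_sub_four (he : 2 < e) (hq : Fintype.card F = 2 ^ e) {γ : Fˣ →* ℂˣ}
    (hγ : Function.Injective γ) {ψ : AddChar F ℂ} (hψ : ψ ≠ 1) :
    charInner (chi5 γ ψ (Fintype.card F - 4)) (resChar (parabolicP F) (chi1 γ 1 2)) = 2 := by
  have := charP_two_of_card hq
  obtain ⟨z, hz⟩ := exists_unit_pow_ne_one he hq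
  exact charInner_chi5_chi1 hγ hψ (units_pow_card_sub_four_add_three he hq) hz

theorem not_isStrongGelfand_stab_stdPlane (he : 2 < e) (hq : Fintype.card F = 2 ^ e) :
    ¬ IsStrongGelfand (stab (stdPlane F)) := by
  intro h
  obtain ⟨γ, hγ⟩ := exists_injective_unitsHom (F := F)
  obtain ⟨ψ, hψ⟩ := exists_addChar_ne_one (F := F)
  have h1 := h _ (isIrrChar_chi5_card_sub_four he hq hγ hψ) _ (isIrrChar_chi1 he hq hγ)
  have h2 := charInner_chi5_card_sub_four he hq hγ hψ
  have h3 := charInner_indChar (parabolicP F) (chi5 γ ψ (Fintype.card F - 4)) (chi1 γ 1 2)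
    (indChar_conj _ _)
  rw [h2] at h3
  change (charInner (indChar (parabolicP F) _) _).re ≤ 1 at h1
  rw [h3] at h1
  norm_num at h1

/-- In characteristic two all maximal parabolic subgroups are equivalent under `Aut (Sp₄(F))`. -/
theorem exists_mulEquiv_mem_stab_iff [CharP F 2] {U : Submodule F (Vec F)}
    (hiso : IsTotallyIsotropic U) (hU : Module.finrank F U = 1 ∨ Module.finrank F U = 2) :
    ∃ φ : Sp4 F ≃* Sp4 F, ∀ g, g ∈ stab U ↔ φ g ∈ stab (stdPlane F) := by
  rcases hU with hU | hU
  · obtain ⟨g, hg⟩ := exists_mem_iff_mem_stdLine hU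
    exact ⟨(MulAut.conj g).trans graphEquiv, fun h =>
      (mem_stab_iff_conj hg h).trans (mem_stab_stdLine_iff_graphEquiv_mem _)⟩
  · obtain ⟨g, hg⟩ := exists_mem_iff_mem_stdPlane hU hiso
    exact ⟨MulAut.conj g, mem_stab_iff_conj hg⟩

theorem not_isStrongGelfand_stab (he : 2 < e) (hq : Fintype.card F = 2 ^ e)
    {U : Submodule F (Vec F)} (hiso : IsTotallyIsotropic U)
    (hU : Module.finrank F U = 1 ∨ Module.finrank F U = 2) : ¬ IsStrongGelfand (stab U) := by
  have := charP_two_of_card hq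
  obtain ⟨φ, hφ⟩ := exists_mulEquiv_mem_stab_iff hiso hU
  exact fun h => not_isStrongGelfand_stab_stdPlane he hq (h.of_equiv φ hφ)

theorem stab_ne_top [CharP F 2] {U : Submodule F (Vec F)} (hiso : IsTotallyIsotropic U)
    (hU : Module.finrank F U = 1 ∨ Module.finrank F U = 2) : stab U ≠ ⊤ := by
  obtain ⟨φ, hφ⟩ := exists_mulEquiv_mem_stab_iff hiso hU
  intro h
  have hJ := (hφ (φ.symm (SymplecticGroup.symJ (Fin 2) F))).1 (h ▸ Subgroup.mem_top _)
  rw [φ.apply_symm_apply] at hJ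
  have := mem_parabolicP_iff.1 hJ 0 0
  simp [SymplecticGroup.symJ, Matrix.J] at this

end Parabolic

/-! ### Subgroups normalizing a 2-subgroup are contained in parabolic subgroups -/

section FixedSpace

variable {F : Type*} [Field F]

variable (F) in
/-- The symplectic form `(u, v) ↦ uᵀ J v`. -/
def sympForm : LinearMap.BilinForm F (Vec F) := Matrix.toBilin' (Matrix.J (Fin 2) F)

theorem sympForm_apply (u v : Vec F) : sympForm F u v = u ⬝ᵥ (Matrix.J (Fin 2) F *ᵥ v) :=
  Matrix.toBilin'_apply' _ _ _

theorem sympForm_mulVec (g : Sp4 F) (u v : Vec F) :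
    sympForm F (g.1 *ᵥ u) (g.1 *ᵥ v) = sympForm F u v := by
  rw [sympForm_apply, sympForm_apply, dotProduct_J_mulVec_mulVec]

theorem sympForm_nondegenerate : (sympForm F).Nondegenerate :=
  (Matrix.nondegenerate_of_det_ne_zero (Matrix.isUnit_det_J (Fin 2) F).ne_zero).toBilin'

/-- The vectors fixed by all elements of `N`. -/
def fixedSpace (N : Subgroup (Sp4 F)) : Submodule F (Vec F) where
  carrier := {v | ∀ n ∈ N, n.1 *ᵥ v = v}
  zero_mem' n _ := Matrix.mulVec_zero _
  add_mem' ha hb n hn := by rw [Matrix.mulVec_add, ha n hn, hb n hn]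
  smul_mem' c v hv n hn := by rw [Matrix.mulVec_smul, hv n hn]

/-- The radical of the form on the space of fixed vectors of `N`. -/
def fixedRadical (N : Subgroup (Sp4 F)) : Submodule F (Vec F) :=
  fixedSpace N ⊓ (sympForm F).orthogonal (fixedSpace N)

theorem isTotallyIsotropic_fixedRadical (N : Subgroup (Sp4 F)) :
    IsTotallyIsotropic (fixedRadical N) := fun u hu v hv => by
  rw [← sympForm_apply]
  exact LinearMap.BilinForm.mem_orthogonal_iff.1 hv.2 u hu.1

theorem mulVec_sub_mem_orthogonal {N : Subgroup (Sp4 F)} {n : Sp4 F} (hn : n ∈ N) (v : Vec F) :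
    n.1 *ᵥ v - v ∈ (sympForm F).orthogonal (fixedSpace N) := by
  refine LinearMap.BilinForm.mem_orthogonal_iff.2 fun w hw => ?_
  rw [map_sub, sub_eq_zero]
  nth_rw 1 [← hw n hn]
  exact sympForm_mulVec n w v

theorem finrank_le_two_of_isTotallyIsotropic {U : Submodule F (Vec F)}
    (hU : IsTotallyIsotropic U) : Module.finrank F U ≤ 2 := by
  have h : U ≤ (sympForm F).orthogonal U := fun v hv =>
    LinearMap.BilinForm.mem_orthogonal_iff.2 fun u hu => by
      rw [sympForm_apply]; exact hU u hu v hv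
  have h1 := Submodule.finrank_mono h
  rw [LinearMap.BilinForm.finrank_orthogonal sympForm_nondegenerate] at h1
  have h2 : Module.finrank F (Vec F) = 4 := by simp [Vec]
  omega

/-- A `p`-group of symplectic matrices in characteristic `p` acts on the orthogonal complement of
its space of fixed vectors, and has a nonzero fixed vector there. -/
theorem fixedRadical_ne_bot [Finite F] {p : ℕ} [Fact p.Prime] [CharP F p] {N : Subgroup (Sp4 F)}
    (hN : IsPGroup p N) (hne : N ≠ ⊥) : fixedRadical N ≠ ⊥ := by
  have := Fintype.ofFinite F
  set W' := (sympForm F).orthogonal (fixedSpace N) with hW'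
  have hW'ne : W' ≠ ⊥ := by
    refine fun hbot => hne ((Subgroup.eq_bot_iff_forall N).2 fun n hn => ?_)
    refine Subtype.ext (Matrix.ext_of_mulVec_single fun i => ?_)
    have h := mulVec_sub_mem_orthogonal hn (Pi.single i 1)
    rw [← hW', hbot, Submodule.mem_bot, sub_eq_zero] at h
    exact h.trans (Matrix.one_mulVec _).symm
  let act : MulAction N W' :=
    { smul := fun n v => ⟨n.1.1 *ᵥ v.1, by
        have h := add_mem (mulVec_sub_mem_orthogonal n.2 v.1) v.2
        rwa [sub_add_cancel] at h⟩
      one_smul := fun v => Subtype.ext (Matrix.one_mulVec _)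
      mul_smul := fun m n v => Subtype.ext (coe_mul_mulVec m.1 n.1 v.1) }
  have hdvd : p ∣ Nat.card W' := by
    have := Fintype.ofFinite W'
    rw [Nat.card_eq_fintype_card, Module.card_eq_pow_finrank (K := F)]
    refine dvd_pow ?_ fun h => hW'ne (Submodule.finrank_eq_zero.1 h)
    obtain ⟨n, -, hn⟩ := FiniteField.card F p
    exact hn ▸ dvd_pow_self p n.ne_zero
  obtain ⟨b, hb, hb0⟩ := hN.exists_fixed_point_of_prime_dvd_card_of_fixed_point W' hdvd (a := 0)
    fun n => Subtype.ext (Matrix.mulVec_zero n.1.1)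
  refine (Submodule.ne_bot_iff _).2 ⟨b.1, ⟨fun n hn => ?_, b.2⟩, fun h => hb0 (Subtype.ext h.symm)⟩
  exact congrArg Subtype.val (hb ⟨n, hn⟩)

theorem mulVec_mem_fixedSpace {N : Subgroup (Sp4 F)} {h : Sp4 F}
    (hh : ∀ n ∈ N, h⁻¹ * n * h ∈ N) {v : Vec F} (hv : v ∈ fixedSpace N) :
    h.1 *ᵥ v ∈ fixedSpace N := fun n hn => by
  have := hv _ (hh n hn)
  rw [coe_mul_mulVec, coe_mul_mulVec] at this
  rw [← mulVec_inv_mulVec h (n.1 *ᵥ h.1 *ᵥ v), this]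

theorem normalizer_le_stab_fixedRadical (N : Subgroup (Sp4 F)) :
    Subgroup.normalizer (N : Set (Sp4 F)) ≤ stab (fixedRadical N) := by
  intro h hh
  refine mem_stab_iff.2 fun v hv => ⟨mulVec_mem_fixedSpace (fun n hn => ?_) hv.1,
    LinearMap.BilinForm.mem_orthogonal_iff.2 fun w hw => ?_⟩
  · exact (Subgroup.mem_normalizer_iff''.1 hh n).1 hn
  · have hw' : (h⁻¹).1 *ᵥ w ∈ fixedSpace N := mulVec_mem_fixedSpace (fun n hn => by
      rw [inv_inv]; exact (Subgroup.mem_normalizer_iff.1 hh n).1 hn) hw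
    rw [← mulVec_inv_mulVec h w, sympForm_mulVec]
    exact LinearMap.BilinForm.mem_orthogonal_iff.1 hv.2 _ hw'

/-- A maximal subgroup normalizing a nontrivial 2-subgroup in characteristic two is a maximal
parabolic subgroup. -/
theorem exists_eq_stab_of_isCoatom [Fintype F] [CharP F 2] {H : Subgroup (Sp4 F)}
    (hH : IsCoatom H) {N : Subgroup H} [N.Normal] (hN : IsPGroup 2 N) (hne : N ≠ ⊥) :
    ∃ U : Submodule F (Vec F), IsTotallyIsotropic U ∧
      (Module.finrank F U = 1 ∨ Module.finrank F U = 2) ∧ H = stab U := by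
  set N' : Subgroup (Sp4 F) := N.map H.subtype with hN'
  have hne' : N' ≠ ⊥ := fun h => hne ((Subgroup.map_eq_bot_iff_of_injective N
    H.subtype_injective).1 h)
  have hiso := isTotallyIsotropic_fixedRadical N'
  have hfin : Module.finrank F (fixedRadical N') = 1 ∨ Module.finrank F (fixedRadical N') = 2 := by
    have h0 : Module.finrank F (fixedRadical N') ≠ 0 := fun h =>
      fixedRadical_ne_bot (hN.map H.subtype) hne' (Submodule.finrank_eq_zero.1 h)
    have h2 := finrank_le_two_of_isTotallyIsotropic hiso
    omega
  have hle : H ≤ stab (fixedRadical N') := by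
    refine le_trans (fun h hh => ?_) (normalizer_le_stab_fixedRadical N')
    have hx : (⟨h, hh⟩ : H) ∈ Subgroup.normalizer (N : Set H) := by
      rw [Subgroup.normalizer_eq_top]
      exact Subgroup.mem_top _
    exact Subgroup.le_normalizer_map H.subtype (Subgroup.mem_map_of_mem H.subtype hx)
  exact ⟨fixedRadical N', hiso, hfin,
    ((hH.le_iff.1 hle).resolve_left (stab_ne_top hiso hfin)).symm⟩

theorem not_isStrongGelfand_of_hasShape [Fintype F] {e : ℕ} (he : 2 < e)
    (hq : Fintype.card F = 2 ^ e) {H : Subgroup (Sp4 F)} (hH : IsCoatom H) (hs : HasShape F H) :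
    ¬ IsStrongGelfand H := by
  have := charP_two_of_card hq
  obtain ⟨N, -, hN, -, hcard, -, -⟩ := hs
  rw [hq, ← pow_mul] at hcard
  have hne : N ≠ ⊥ := fun h => by
    rw [h, Subgroup.card_bot] at hcard
    exact (Nat.one_lt_two_pow (n := e * 3) (by omega)).ne hcard
  obtain ⟨U, hiso, hU, rfl⟩ := exists_eq_stab_of_isCoatom hH (IsPGroup.of_card hcard) hne
  exact not_isStrongGelfand_stab he hq hiso hU

end FixedSpace

end StrongGelfand

end

theorem mainTheorem3 (F : Type*) [Field F] [Fintype F] (e : ℕ) (he : 2 < e)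
    (hq : Fintype.card F = 2 ^ e) :
    -- the maximal parabolic subgroups are not strong Gelfand subgroups
    (∀ U : Submodule F (StrongGelfand.Vec F), StrongGelfand.IsTotallyIsotropic U →
      (Module.finrank F U = 1 ∨ Module.finrank F U = 2) →
        ¬ StrongGelfand.IsStrongGelfand (StrongGelfand.stab U)) ∧
    -- no maximal subgroup of shape `E_q³ : GL₂(q)` is a strong Gelfand subgroup
    (∀ H : Subgroup (StrongGelfand.Sp4 F), IsCoatom H → StrongGelfand.HasShape F H →
        ¬ StrongGelfand.IsStrongGelfand H) ∧
    -- the explicit multiplicity two, for every choice of the embedding and of `ψ`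
    (∀ γ : Fˣ →* ℂˣ, Function.Injective γ → ∀ ψ : AddChar F ℂ, ψ ≠ 1 →
      StrongGelfand.IsIrrChar (StrongGelfand.chi5 γ ψ (Fintype.card F - 4)) ∧
      StrongGelfand.IsIrrChar (StrongGelfand.chi1 γ 1 2) ∧
      StrongGelfand.charInner (StrongGelfand.chi5 γ ψ (Fintype.card F - 4))
        (StrongGelfand.resChar (StrongGelfand.parabolicP F) (StrongGelfand.chi1 γ 1 2)) = 2) :=
  ⟨fun _ hiso hU => StrongGelfand.not_isStrongGelfand_stab he hq hiso hU,
    fun _ hH hs => StrongGelfand.not_isStrongGelfand_of_hasShape he hq hH hs,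
    fun _ hγ _ hψ => ⟨StrongGelfand.isIrrChar_chi5_card_sub_four he hq hγ hψ,
      StrongGelfand.isIrrChar_chi1 he hq hγ,
      StrongGelfand.charInner_chi5_card_sub_four he hq hγ hψ⟩⟩
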